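/- **Notation.** For real $s\ge 0$ and $f\in L^2(\mathbb R)$ let $\|f\|_s=\|(1+\xi^2)^{s/2}\hat f(\xi)\|_{L^2}$ (unitary Fourier transform) be the Sobolev norm, and $\Lambda^{-2}=(1-\partial_x^2)^{-1}$ the Fourier multiplier with symbol $(1+\xi^2)^{-1}$. For $0<\delta\le 1$ and $s\ge 2$ set $$\|f\|_{(\delta,s)}=\sup_{k\ge 0}\frac{\delta^k(k+1)^2\|f^{(k)}\|_s}{k!},$$ let $E_{\delta,s}$ be the space of real-valued $f\in\mathcal C^\infty(\mathbb R)$ with $\|f\|_{(\delta,s)}<\infty$, and let $E_{\delta,s}^{\mathbb C}$ be its complexification, the space of complex-valued $f\in\mathcal C^\infty(\mathbb R)$ with $\|f\|_{(\delta,s)}<\infty$. Put $\|(u,v)\|_{(\delta,s)}=\|u\|_{(\delta,s)}+\|v\|_{(\delta,s)}$. Let $\alpha,\beta\in\mathbb R$. The Cauchy problem for the generalized two-component Camassa–Holm system is $$\begin{cases}u_t+\beta uu_x+\Lambda^{-2}\partial_x\left[-\alpha u+\frac{3-\beta}{2}u^2+\frac{\beta}{2}u_x^2+v+\frac12v^2\right]=0,\\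 v_t+u_x+(uv)_x=0,\\ u(0,x)=u_0(x),\quad v(0,x)=v_0(x).\end{cases}\qquad(\ast)$$ **Theorem 2.2.** Let $\alpha,\beta\in\mathbb R$ and let $s\ge2$ be real. To every pair $(u_0,v_0)\in E_{1,s+1}\oplus E_{1,s+1}$ one can assign a time $T=T(u_0,v_0)>0$ (depending also on $\alpha,\beta,s$) such that the following holds. 1. For every $\delta\in(0,1)$ the problem $(\ast)$ has one and only one solution $(u,v)$ which is a holomorphic function of $t$ on the disk $\{t\in\mathbb C:|t|<T(1-\delta)\}$ with values in $E^{\mathbb C}_{\delta,s+1}\oplus E^{\mathbb C}_{\delta,s+1}$; for real $t$ in the disk its values lie in $E_{\delta,s+1}\oplus E_{\delta,s+1}$. 2. There are constants $c_\infty,c_0>0$, depending only on $\alpha,\beta,s$, such that, uniformly in the data, $$T(u_0,v_0)\,\|(u_0,v_0)\|_{(1,s+1)}\to c_\infty\quad\text{as }\|(u_0,v_0)\|_{(1,s+1)}\to\infty,$$ $$T(u_0,v_0)\to c_0\quad\text{as }\|(u_0,v_0)\|_{(1,s+1)}\to0.$$ Here the second limit includes zero data: for every $\varepsilon>0$ there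 is $\eta>0$ such that $|T(u_0,v_0)-c_0|<\varepsilon$ whenever $\|(u_0,v_0)\|_{(1,s+1)}<\eta$. -/

import Mathlib

open MeasureTheory Filter Topology
open scoped ENNReal FourierTransform ContDiff

noncomputable section

namespace GenCH

/-! ### Fourier transform, Sobolev norms and Fourier multipliers on the line -/

open Classical in
/-- The (Plancherel) Fourier transform of a square-integrable function `f : ℝ → ℂ`, in Mathlib's
normalization `∫ exp (-2πi x ξ) f x dx` (and `0` if `f` is not square integrable). -/
def fourierL2 (f : ℝ → ℂ) : ℝ → ℂ :=
  if h : MemLp f 2 (volume : Measure ℝ) then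
    ((𝓕 (h.toLp f) : Lp ℂ 2 (volume : Measure ℝ)) : ℝ → ℂ)
  else 0

/-- The symbol of `1 - ∂ₓ²` with respect to the Fourier transform above. It is `1 + η²` in terms of
the angular frequency `η = 2πξ`. -/
def symb (ξ : ℝ) : ℝ := 1 + (2 * Real.pi * ξ) ^ 2

open Classical in
/-- The Sobolev norm `‖f‖ₛ = ‖(1 + η²)^(s/2) f̂(η)‖_{L²(dη)}`, where `f̂` is the unitary Fourier
transform in the angular frequency `η`; with `η = 2πξ` this is the same number as the `L²(dξ)` norm
of `(1 + (2πξ)²)^(s/2) 𝓕f(ξ)`. It is infinite for functions that are not square integrable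
(the spaces `H^s` with `s ≥ 0` are subspaces of `L²`). -/
def sobolevENorm (s : ℝ) (f : ℝ → ℂ) : ℝ≥0∞ :=
  if MemLp f 2 (volume : Measure ℝ) then
    eLpNorm (fun ξ : ℝ => ((symb ξ ^ (s / 2) : ℝ) : ℂ) * fourierL2 f ξ) 2 volume
  else ⊤

/-- The operator `Λ⁻² = (1 - ∂ₓ²)⁻¹` on `L²`, as a Fourier multiplier. For `g ∈ L²` the product
`(1 + (2πξ)²)⁻¹ 𝓕g(ξ)` is integrable, so that the inverse Fourier integral converges at every
point; it is the continuous representative of `Λ⁻² g ∈ H²`. -/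
def invHelmholtz (g : ℝ → ℂ) : ℝ → ℂ :=
  𝓕⁻ (fun ξ : ℝ => (((symb ξ)⁻¹ : ℝ) : ℂ) * fourierL2 g ξ)

/-- The norm `‖f‖_(δ,s) = sup_k δ^k (k+1)² ‖f^(k)‖ₛ / k!`, with values in `[0, ∞]`. -/
def eNormE (δ s : ℝ) (f : ℝ → ℂ) : ℝ≥0∞ :=
  ⨆ k : ℕ, ENNReal.ofReal (δ ^ k * ((k : ℝ) + 1) ^ 2 / (k.factorial : ℝ))
    * sobolevENorm s (iteratedDeriv k f)

/-! ### Elementary properties, needed for the normed space structure -/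

lemma symb_pos (ξ : ℝ) : 0 < symb ξ := by unfold symb; positivity

lemma measurable_symb_rpow (a : ℝ) : Measurable (fun ξ : ℝ => ((symb ξ ^ a : ℝ) : ℂ)) := by
  unfold symb
  fun_prop

lemma fourierL2_of_memLp {f : ℝ → ℂ} (h : MemLp f 2 (volume : Measure ℝ)) :
    fourierL2 f = ((𝓕 (h.toLp f) : Lp ℂ 2 (volume : Measure ℝ)) : ℝ → ℂ) := by
  simp [fourierL2, h]

lemma aestronglyMeasurable_fourierL2 (f : ℝ → ℂ) :
    AEStronglyMeasurable (fourierL2 f) (volume : Measure ℝ) := by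
  by_cases h : MemLp f 2 (volume : Measure ℝ)
  · rw [fourierL2_of_memLp h]
    exact Lp.aestronglyMeasurable _
  · simp only [fourierL2, h, dite_false]
    exact aestronglyMeasurable_zero

lemma fourierL2_add {f g : ℝ → ℂ} (hf : MemLp f 2 (volume : Measure ℝ))
    (hg : MemLp g 2 (volume : Measure ℝ)) :
    fourierL2 (f + g) =ᵐ[volume] fourierL2 f + fourierL2 g := by
  rw [fourierL2_of_memLp hf, fourierL2_of_memLp hg, fourierL2_of_memLp (hf.add hg),
    MemLp.toLp_add hf hg, FourierTransform.fourier_add]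
  exact Lp.coeFn_add _ _

lemma fourierL2_smul (c : ℂ) {f : ℝ → ℂ} (hf : MemLp f 2 (volume : Measure ℝ)) :
    fourierL2 (c • f) =ᵐ[volume] c • fourierL2 f := by
  rw [fourierL2_of_memLp hf, fourierL2_of_memLp (hf.const_smul c),
    MemLp.toLp_const_smul c hf, FourierTransform.fourier_smul]
  exact Lp.coeFn_smul _ _

lemma sobolevENorm_add_le (s : ℝ) (f g : ℝ → ℂ) :
    sobolevENorm s (f + g) ≤ sobolevENorm s f + sobolevENorm s g := by
  by_cases hf : MemLp f 2 (volume : Measure ℝ)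
  swap
  · simp [sobolevENorm, hf]
  by_cases hg : MemLp g 2 (volume : Measure ℝ)
  swap
  · simp [sobolevENorm, hg]
  simp only [sobolevENorm, hf, hg, hf.add hg, if_true]
  have h : (fun ξ : ℝ => ((symb ξ ^ (s / 2) : ℝ) : ℂ) * fourierL2 (f + g) ξ) =ᵐ[volume]
      (fun ξ : ℝ => ((symb ξ ^ (s / 2) : ℝ) : ℂ) * fourierL2 f ξ)
        + (fun ξ : ℝ => ((symb ξ ^ (s / 2) : ℝ) : ℂ) * fourierL2 g ξ) := by
    filter_upwards [fourierL2_add hf hg] with ξ hξ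
    simp only [Pi.add_apply] at hξ ⊢
    rw [hξ, mul_add]
  rw [eLpNorm_congr_ae h]
  refine eLpNorm_add_le ?_ ?_ (by norm_num)
  · exact (measurable_symb_rpow _).aestronglyMeasurable.mul (aestronglyMeasurable_fourierL2 f)
  · exact (measurable_symb_rpow _).aestronglyMeasurable.mul (aestronglyMeasurable_fourierL2 g)

lemma sobolevENorm_smul_le (s : ℝ) (c : ℂ) (f : ℝ → ℂ) :
    sobolevENorm s (c • f) ≤ ‖c‖ₑ * sobolevENorm s f := by
  have key : ∀ g : ℝ → ℂ, MemLp g 2 (volume : Measure ℝ) →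
      sobolevENorm s (c • g) = ‖c‖ₑ * sobolevENorm s g := by
    intro g hg
    simp only [sobolevENorm, hg, hg.const_smul c, if_true]
    have h : (fun ξ : ℝ => ((symb ξ ^ (s / 2) : ℝ) : ℂ) * fourierL2 (c • g) ξ) =ᵐ[volume]
        c • (fun ξ : ℝ => ((symb ξ ^ (s / 2) : ℝ) : ℂ) * fourierL2 g ξ) := by
      filter_upwards [fourierL2_smul c hg] with ξ hξ
      simp only [Pi.smul_apply, smul_eq_mul] at hξ ⊢
      rw [hξ]
      ring
    rw [eLpNorm_congr_ae h, eLpNorm_const_smul]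
  by_cases hf : MemLp f 2 (volume : Measure ℝ)
  · exact (key f hf).le
  · by_cases hc : c = 0
    · subst hc
      have h0 := key 0 MemLp.zero
      simp only [smul_zero, enorm_zero, zero_mul] at h0
      simp [h0]
    · have : ‖c‖ₑ * sobolevENorm s f = ⊤ := by
        simp only [sobolevENorm, hf, if_false]
        exact ENNReal.mul_top (by simpa using hc)
      rw [this]
      exact le_top

lemma eq_zero_of_sobolevENorm_eq_zero {s : ℝ} {f : ℝ → ℂ} (hc : Continuous f)
    (h : sobolevENorm s f = 0) : f = 0 := by
  have hf : MemLp f 2 (volume : Measure ℝ) := by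
    by_contra hf
    simp [sobolevENorm, hf] at h
  simp only [sobolevENorm, hf, if_true] at h
  have hm : AEStronglyMeasurable
      (fun ξ : ℝ => ((symb ξ ^ (s / 2) : ℝ) : ℂ) * fourierL2 f ξ) volume :=
    (measurable_symb_rpow _).aestronglyMeasurable.mul (aestronglyMeasurable_fourierL2 f)
  rw [eLpNorm_eq_zero_iff hm (by norm_num)] at h
  have h1 : fourierL2 f =ᵐ[volume] 0 := by
    filter_upwards [h] with ξ hξ
    have hp : ((symb ξ ^ (s / 2) : ℝ) : ℂ) ≠ 0 := by
      exact_mod_cast (Real.rpow_pos_of_pos (symb_pos ξ) _).ne'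
    simpa [hp] using hξ
  rw [fourierL2_of_memLp hf] at h1
  have h2 : (𝓕 (hf.toLp f) : Lp ℂ 2 (volume : Measure ℝ)) = 0 := (Lp.eq_zero_iff_ae_eq_zero).2 h1
  have h3 : hf.toLp f = 0 := by
    rw [← norm_eq_zero, ← Lp.norm_fourier_eq, h2, norm_zero]
  have h4 : f =ᵐ[volume] 0 := by
    have := hf.coeFn_toLp
    rw [h3] at this
    exact this.symm.trans (Lp.coeFn_zero _ _ _)
  exact Continuous.ae_eq_iff_eq volume hc continuous_zero |>.1 h4

lemma eNormE_add_le (δ s : ℝ) {f g : ℝ → ℂ} (hf : ContDiff ℝ ∞ f) (hg : ContDiff ℝ ∞ g) :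
    eNormE δ s (f + g) ≤ eNormE δ s f + eNormE δ s g := by
  refine iSup_le fun k => ?_
  have hk : iteratedDeriv k (f + g) = iteratedDeriv k f + iteratedDeriv k g := by
    funext x
    exact iteratedDeriv_add ((hf.of_le (by exact_mod_cast le_top)).contDiffAt)
      ((hg.of_le (by exact_mod_cast le_top)).contDiffAt)
  rw [hk]
  calc _ ≤ _ := mul_le_mul_right (sobolevENorm_add_le s _ _) _
    _ = _ := mul_add _ _ _
    _ ≤ _ := add_le_add
      (le_iSup (fun k : ℕ => ENNReal.ofReal (δ ^ k * ((k : ℝ) + 1) ^ 2 / (k.factorial : ℝ))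
        * sobolevENorm s (iteratedDeriv k f)) k)
      (le_iSup (fun k : ℕ => ENNReal.ofReal (δ ^ k * ((k : ℝ) + 1) ^ 2 / (k.factorial : ℝ))
        * sobolevENorm s (iteratedDeriv k g)) k)

lemma eNormE_smul_le (δ s : ℝ) (c : ℂ) (f : ℝ → ℂ) :
    eNormE δ s (c • f) ≤ ‖c‖ₑ * eNormE δ s f := by
  refine iSup_le fun k => ?_
  have hk : iteratedDeriv k (c • f) = c • iteratedDeriv k f := by
    funext x
    exact iteratedDeriv_const_smul_field c f
  rw [hk]
  calc _ ≤ _ := mul_le_mul_right (sobolevENorm_smul_le s c _) _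
    _ = _ := mul_left_comm _ _ _
    _ ≤ _ := mul_le_mul_right
      (le_iSup (fun k : ℕ => ENNReal.ofReal (δ ^ k * ((k : ℝ) + 1) ^ 2 / (k.factorial : ℝ))
        * sobolevENorm s (iteratedDeriv k f)) k) _

lemma eNormE_zero (δ s : ℝ) : eNormE δ s 0 = 0 := by
  have h := eNormE_smul_le δ s 0 0
  simpa using h

lemma sobolevENorm_le_eNormE (δ s : ℝ) (f : ℝ → ℂ) : sobolevENorm s f ≤ eNormE δ s f := by
  have h := le_iSup (fun k : ℕ => ENNReal.ofReal (δ ^ k * ((k : ℝ) + 1) ^ 2 / (k.factorial : ℝ))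
        * sobolevENorm s (iteratedDeriv k f)) 0
  simpa [eNormE] using h

/-! ### The spaces `E_{δ,s}` -/

/-- The vector space underlying the complexification of `E_{δ,s}`: the smooth functions
`f : ℝ → ℂ` with `‖f‖_(δ,s) < ∞`. -/
def submoduleE (δ s : ℝ) : Submodule ℂ (ℝ → ℂ) where
  carrier := {f | ContDiff ℝ ∞ f ∧ eNormE δ s f < ⊤}
  add_mem' := fun hf hg => ⟨hf.1.add hg.1,
    (eNormE_add_le δ s hf.1 hg.1).trans_lt (ENNReal.add_lt_top.2 ⟨hf.2, hg.2⟩)⟩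
  zero_mem' := ⟨contDiff_const, by simp [eNormE_zero]⟩
  smul_mem' := fun c _ hf => ⟨contDiff_const.smul hf.1,
    (eNormE_smul_le δ s c _).trans_lt (ENNReal.mul_lt_top enorm_lt_top hf.2)⟩

/-- The complexification of `E_{δ,s}` (complex time needs complex-valued functions of `x`). It is a
separate type, so that its only topology is that of the norm `‖·‖_(δ,s)`. -/
def EC (δ s : ℝ) : Type := submoduleE δ s

instance (δ s : ℝ) : AddCommGroup (EC δ s) := inferInstanceAs (AddCommGroup (submoduleE δ s))

instance (δ s : ℝ) : Module ℂ (EC δ s) := inferInstanceAs (Module ℂ (submoduleE δ s))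

/-- An element of the space is a function on the real line. -/
instance (δ s : ℝ) : CoeFun (EC δ s) (fun _ => ℝ → ℂ) := ⟨fun f => f.1⟩

instance (δ s : ℝ) : Norm (EC δ s) := ⟨fun f => (eNormE δ s f).toReal⟩

lemma EC.norm_def {δ s : ℝ} (f : EC δ s) : ‖f‖ = (eNormE δ s f).toReal := rfl

lemma EC.norm_smul_le {δ s : ℝ} (c : ℂ) (f : EC δ s) : ‖c • f‖ ≤ ‖c‖ * ‖f‖ := by
  rw [EC.norm_def, EC.norm_def, ← toReal_enorm c, ← ENNReal.toReal_mul]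
  exact ENNReal.toReal_mono (ENNReal.mul_lt_top enorm_lt_top f.2.2).ne (eNormE_smul_le δ s c f.1)

lemma EC.core (δ s : ℝ) : NormedSpace.Core ℂ (EC δ s) where
  norm_nonneg _ := ENNReal.toReal_nonneg
  norm_smul c f := by
    refine le_antisymm (EC.norm_smul_le c f) ?_
    by_cases hc : c = 0
    · subst hc
      simp only [norm_zero, zero_mul]
      exact ENNReal.toReal_nonneg
    · have h := EC.norm_smul_le c⁻¹ (c • f)
      rw [inv_smul_smul₀ hc, norm_inv] at h
      calc ‖c‖ * ‖f‖ ≤ ‖c‖ * (‖c‖⁻¹ * ‖c • f‖) := by gcongr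
        _ = ‖c • f‖ := by
          rw [← mul_assoc, mul_inv_cancel₀ (by simpa using hc), one_mul]
  norm_triangle f g := by
    rw [EC.norm_def, EC.norm_def, EC.norm_def, ← ENNReal.toReal_add f.2.2.ne g.2.2.ne]
    exact ENNReal.toReal_mono (ENNReal.add_lt_top.2 ⟨f.2.2, g.2.2⟩).ne
      (eNormE_add_le δ s f.2.1 g.2.1)
  norm_eq_zero_iff f := by
    constructor
    · intro h
      have h1 : eNormE δ s f.1 = 0 :=
        ((ENNReal.toReal_eq_zero_iff _).1 h).resolve_right f.2.2.ne
      have h2 : sobolevENorm s f.1 = 0 :=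
        le_antisymm ((sobolevENorm_le_eNormE δ s f.1).trans h1.le) zero_le
      exact Subtype.ext (eq_zero_of_sobolevENorm_eq_zero f.2.1.continuous h2)
    · rintro rfl
      change (eNormE δ s 0).toReal = 0
      simp [eNormE_zero]

instance (δ s : ℝ) : NormedAddCommGroup (EC δ s) := NormedAddCommGroup.ofCore (EC.core δ s)

instance (δ s : ℝ) : NormedSpace ℂ (EC δ s) := NormedSpace.ofCore (EC.core δ s)

/-- The space `E_{δ,s}` of real-valued functions, as a subset of its complexification. -/
def E (δ s : ℝ) : Set (EC δ s) := {f | ∀ x : ℝ, (f x).im = 0}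

/-! ### The Cauchy problem -/

/-- The norm `‖(u₀,v₀)‖_(δ,s) = ‖u₀‖_(δ,s) + ‖v₀‖_(δ,s)` of a pair of real-valued functions. -/
def pairNorm {δ s : ℝ} (p : E δ s × E δ s) : ℝ := ‖(p.1 : EC δ s)‖ + ‖(p.2 : EC δ s)‖

/-- `U = (u,v)` is a holomorphic solution on the disk `|t| < r`, with values in (the complexification
of) `E_{δ,σ} ⊕ E_{δ,σ}`, of the Cauchy problem

`u_t + β u u_x + Λ⁻² ∂ₓ [-α u + (3-β)/2 u² + β/2 u_x² + v + 1/2 v²] = 0`,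
`v_t + u_x + (u v)_x = 0`, `u(0,x) = u₀(x)`, `v(0,x) = v₀(x)`.

The time derivative `deriv U t` is taken in the norm of `E_{δ,σ} ⊕ E_{δ,σ}`. -/
structure IsHolomorphicSolution (α β : ℝ) {δ σ : ℝ} (u₀ v₀ : ℝ → ℂ) (r : ℝ)
    (U : ℂ → EC δ σ × EC δ σ) : Prop where
  holomorphic : DifferentiableOn ℂ U (Metric.ball 0 r)
  init_u : ∀ x : ℝ, (U 0).1 x = u₀ x
  init_v : ∀ x : ℝ, (U 0).2 x = v₀ x
  eq_u : ∀ t ∈ Metric.ball (0 : ℂ) r, ∀ x : ℝ,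
    (deriv U t).1 x + (β : ℂ) * (U t).1 x * deriv (U t).1 x
      + invHelmholtz (deriv fun y : ℝ =>
          -(α : ℂ) * (U t).1 y + (3 - (β : ℂ)) / 2 * (U t).1 y ^ 2
            + (β : ℂ) / 2 * (deriv (U t).1 y) ^ 2 + (U t).2 y + 1 / 2 * (U t).2 y ^ 2) x = 0
  eq_v : ∀ t ∈ Metric.ball (0 : ℂ) r, ∀ x : ℝ,
    (deriv U t).2 x + deriv (U t).1 x + deriv (fun y : ℝ => (U t).1 y * (U t).2 y) x = 0

end GenCH

end

namespace GenCH

/-! ### The Fourier transform of square-integrable functions -/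

section FourierBasics

open SchwartzMap

/-! The system has the form `U' = L U + B(U, U)` with `L` linear and `B` bilinear, and the
right-hand side loses one `x`-derivative. In the scale `E_{δ,s+1}` this loss is of
Cauchy–Kovalevskaya type. Differentiating costs a factor `1/(δ' - δ)` when passing from radius `δ'`
to `δ < δ'` (`eNormE_deriv_le`). Products are bounded at fixed radius (`HInf.eNormE_mul_le`),
because `H^s` is an algebra for `s ≥ 1` and the weights `(k+1)^2` absorb the Leibniz sum. The term
`u_x^2` costs nothing more: `Λ⁻² ∂ₓ` gains one Sobolev exponent, so the flux need only be measured
in exponent `s`, where `u_x` is controlled by the `s+1` norm of `u`. Hence `L` and `B` are bounded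
from radius `δ'` to `δ` with norm at most `C/(δ' - δ)` when `δ' - δ ≤ 1`.

The solution is a power series `∑ tⁿ aₙ` with `(n+1) aₙ₊₁ = L aₙ + ∑ B(aᵢ, aⱼ)`, the sum over `i + j
= n`. If `N` is the norm of the data, `A = 1 + N` and `K = 216 C A`, then `‖aₙ‖_(δ,s+1) ≤ A Kⁿ
(1-δ)⁻ⁿ (n+1)⁻²` for every `δ < 1` (`taylorCoeff_estimate`). The induction step spends the part
`(1-δ)/(n+2)` of the available radius. The series therefore converges in `E_{δ,s+1}` for `|t| <
(1-δ)/K`, and `T = 1/K = 1/(216 C (1+N))` has both required limits, with the same constant `1/(216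
C)`.

The estimates do not make `L` and `B` operators of a fixed `E_{δ,s+1}` into itself. Their values at
a point are nevertheless continuous forms on it, since point evaluation is already continuous at
radius `δ/2`. So the Cauchy problem becomes a family of scalar quadratic equations tested by a
separating family of functionals (`isHolomorphicSolution_iff`). Termwise differentiation verifies
them for the series. For uniqueness (`IsQuadraticSolution.eqOn`), a difference of two solutions that
is not identically zero near `0` would be `tⁿ g(t)` with `n ≥ 1` and `g 0 ≠ 0`; comparing
lowest-order terms gives `n g 0 = 0`. -/

lemma memLp_fourierL2 (f : ℝ → ℂ) : MemLp (fourierL2 f) 2 (volume : Measure ℝ) := by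
  by_cases h : MemLp f 2 (volume : Measure ℝ)
  · rw [fourierL2_of_memLp h]
    exact Lp.memLp _
  · simp only [fourierL2, h, dite_false]
    exact MemLp.zero

lemma fourierL2_congr_ae {f g : ℝ → ℂ} (h : f =ᵐ[volume] g) : fourierL2 f = fourierL2 g := by
  by_cases hf : MemLp f 2 (volume : Measure ℝ)
  · have hg : MemLp g 2 (volume : Measure ℝ) := (memLp_congr_ae h).1 hf
    rw [fourierL2_of_memLp hf, fourierL2_of_memLp hg, (MemLp.toLp_eq_toLp_iff hf hg).2 h]
  · have hg : ¬ MemLp g 2 (volume : Measure ℝ) := fun hg => hf ((memLp_congr_ae h).2 hg)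
    simp [fourierL2, hf, hg]

/-- The `L²` transform agrees with the transform of tempered distributions, which is defined by this
duality. Later identifications of `fourierL2` are made by testing against Schwartz functions. -/
lemma integral_mul_fourierL2 {f : ℝ → ℂ} (hf : MemLp f 2 (volume : Measure ℝ)) (χ : 𝓢(ℝ, ℂ)) :
    ∫ x, χ x * fourierL2 f x = ∫ x, (𝓕 χ) x * f x := by
  have h := congrArg (fun T => T χ) (Lp.fourier_toTemperedDistribution_eq (hf.toLp f))
  simp only [TemperedDistribution.fourier_apply, Lp.toTemperedDistribution_apply,
    smul_eq_mul] at h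
  rw [fourierL2_of_memLp hf, ← h]
  refine integral_congr_ae ?_
  filter_upwards [hf.coeFn_toLp] with x hx
  rw [hx]

lemma ae_eq_of_integral_schwartz_mul_eq {f g : ℝ → ℂ} (hf : LocallyIntegrable f volume)
    (hg : LocallyIntegrable g volume)
    (h : ∀ χ : 𝓢(ℝ, ℂ), HasCompactSupport χ → ∫ x, χ x * f x = ∫ x, χ x * g x) :
    f =ᵐ[volume] g := by
  refine ae_eq_of_integral_contDiff_smul_eq hf hg fun χ hχ hc => ?_
  have hc' : HasCompactSupport (fun x => (χ x : ℂ)) := hc.comp_left (g := fun x : ℝ => (x : ℂ)) (by simp)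
  exact h (hc'.toSchwartzMap (Complex.ofRealCLM.contDiff.comp hχ)) hc'

lemma memLp_two_schwartz (χ : 𝓢(ℝ, ℂ)) : MemLp (χ : ℝ → ℂ) 2 (volume : Measure ℝ) := χ.memLp 2 volume

lemma locallyIntegrable_of_memLp_two {f : ℝ → ℂ} (hf : MemLp f 2 (volume : Measure ℝ)) :
    LocallyIntegrable f volume :=
  hf.locallyIntegrable (by norm_num)

lemma integral_mul_fourierInv {φ : ℝ → ℂ} (hφ : Integrable φ) (χ : 𝓢(ℝ, ℂ)) :
    ∫ x, (𝓕 χ) x * (𝓕⁻ φ) x = ∫ x, χ x * φ x := by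
  -- The pairing `-innerₗ ℝ` turns the Fourier integral into the inverse one, so that Fubini moves
  -- `𝓕⁻` from `φ` to `𝓕 χ`.
  have h := VectorFourier.integral_fourierIntegral_smul_eq_flip (L := -innerₗ ℝ) (μ := volume)
    (ν := volume) Real.continuous_fourierChar (by exact continuous_inner.neg) hφ
    (𝓕 χ : 𝓢(ℝ, ℂ)).integrable
  have h2 : ∀ x, VectorFourier.fourierIntegral 𝐞 volume (-innerₗ ℝ).flip (𝓕 χ : 𝓢(ℝ, ℂ)) x = χ x := by
    intro x
    have : (𝓕⁻ (𝓕 χ) : 𝓢(ℝ, ℂ)) x = χ x := by simp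
    rw [← this, SchwartzMap.fourierInv_coe]
    rw [Real.fourierInv_eq, VectorFourier.fourierIntegral]
    congr 1
    ext v
    simp [mul_comm, SchwartzMap.fourier_coe]
  simp only [h2] at h
  calc _ = _ := by simp_rw [mul_comm ((𝓕 χ) _)]; exact h
    _ = _ := by simp_rw [smul_eq_mul, mul_comm (φ _)]

lemma continuous_fourierInv {φ : ℝ → ℂ} (hφ : Integrable φ) : Continuous (𝓕⁻ φ) := by
  rw [Real.fourierInv_eq_fourier_comp_neg]
  exact VectorFourier.fourierIntegral_continuous Real.continuous_fourierChar
    (by exact continuous_inner) hφ.comp_neg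

/-- On `L¹ ∩ L²` the inverse Fourier integral and the inverse transform of `L²` agree almost
everywhere, since they have the same integrals against every `χ = 𝓕 (𝓕⁻ χ)`. -/
lemma memLp_fourierInv_and_fourierL2 {φ : ℝ → ℂ} (h1 : Integrable φ)
    (h2 : MemLp φ 2 (volume : Measure ℝ)) :
    MemLp (𝓕⁻ φ) 2 (volume : Measure ℝ) ∧ fourierL2 (𝓕⁻ φ) =ᵐ[volume] φ := by
  set g : Lp ℂ 2 (volume : Measure ℝ) := 𝓕⁻ (h2.toLp φ) with hg
  have hFg : 𝓕 g = h2.toLp φ := FourierTransform.fourier_fourierInv_eq _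
  have hgm : MemLp (g : ℝ → ℂ) 2 (volume : Measure ℝ) := Lp.memLp g
  have hfg : fourierL2 g =ᵐ[volume] φ := by
    rw [fourierL2_of_memLp hgm, Lp.toLp_coeFn, hFg]
    exact h2.coeFn_toLp
  have hae : (𝓕⁻ φ) =ᵐ[volume] (g : ℝ → ℂ) := by
    refine ae_eq_of_integral_schwartz_mul_eq (continuous_fourierInv h1).locallyIntegrable
      (locallyIntegrable_of_memLp_two hgm) fun χ _ => ?_
    have e1 := integral_mul_fourierInv h1 (𝓕⁻ χ)
    have e2 := integral_mul_fourierL2 hgm (𝓕⁻ χ)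
    rw [FourierTransform.fourier_fourierInv_eq] at e1 e2
    rw [e1, ← e2]
    refine integral_congr_ae ?_
    filter_upwards [hfg] with x hx
    rw [hx]
  exact ⟨(memLp_congr_ae hae).2 hgm, by rw [fourierL2_congr_ae hae]; exact hfg⟩

lemma fourierL2_injective {f g : ℝ → ℂ} (hf : MemLp f 2 (volume : Measure ℝ))
    (hg : MemLp g 2 (volume : Measure ℝ)) (h : fourierL2 f =ᵐ[volume] fourierL2 g) :
    f =ᵐ[volume] g := by
  refine ae_eq_of_integral_schwartz_mul_eq (locallyIntegrable_of_memLp_two hf)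
      (locallyIntegrable_of_memLp_two hg) fun χ _ => ?_
  have e1 := integral_mul_fourierL2 hf (𝓕⁻ χ)
  have e2 := integral_mul_fourierL2 hg (𝓕⁻ χ)
  rw [FourierTransform.fourier_fourierInv_eq] at e1 e2
  rw [← e1, ← e2]
  refine integral_congr_ae ?_
  filter_upwards [h] with x hx
  rw [hx]

lemma eq_fourierInv_fourierL2 {f : ℝ → ℂ} (hc : Continuous f)
    (hf : MemLp f 2 (volume : Measure ℝ)) (hi : Integrable (fourierL2 f)) :
    f = 𝓕⁻ (fourierL2 f) := by
  obtain ⟨h1, h2⟩ := memLp_fourierInv_and_fourierL2 hi (memLp_fourierL2 f)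
  exact Continuous.ae_eq_iff_eq volume hc (continuous_fourierInv hi) |>.1
    (fourierL2_injective hf h1 h2.symm)

/-- Integration by parts against `𝓕 χ`, whose derivative is the transform of `-2πi x χ(x)`. Compact
support of `χ` makes that product a Schwartz function at once. -/
lemma fourierL2_deriv {f : ℝ → ℂ} (hd : Differentiable ℝ f) (hf : MemLp f 2 (volume : Measure ℝ))
    (hf' : MemLp (deriv f) 2 (volume : Measure ℝ)) :
    fourierL2 (deriv f) =ᵐ[volume] fun ξ => (2 * Real.pi * Complex.I * ξ) * fourierL2 f ξ := by
  refine ae_eq_of_integral_schwartz_mul_eq (locallyIntegrable_of_memLp_two (memLp_fourierL2 _))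
    ?_ fun χ hχ => ?_
  · exact (locallyIntegrable_of_memLp_two (memLp_fourierL2 f)).continuous_mul
      (g := fun ξ : ℝ => (2 * Real.pi * Complex.I * ξ : ℂ)) (by fun_prop)
  have hc : HasCompactSupport (fun x : ℝ => (-2 * Real.pi * Complex.I * x : ℂ) * χ x) :=
    HasCompactSupport.mul_left (f := fun x : ℝ => (-2 * Real.pi * Complex.I * x : ℂ)) hχ
  have hs : ContDiff ℝ ∞ (fun x : ℝ => (-2 * Real.pi * Complex.I * x : ℂ) * χ x) := by
    refine ContDiff.mul ?_ (χ.smooth _)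
    exact contDiff_const.mul Complex.ofRealCLM.contDiff
  set ψ : 𝓢(ℝ, ℂ) := hc.toSchwartzMap hs with hψ
  have hder : deriv (𝓕 χ : 𝓢(ℝ, ℂ)) = (𝓕 ψ : 𝓢(ℝ, ℂ)) := by
    rw [SchwartzMap.fourier_coe, SchwartzMap.fourier_coe, Real.deriv_fourier χ.integrable]
    · rfl
    · have : Integrable (fun x => (-2 * Real.pi * Complex.I : ℂ)⁻¹ * ψ x) := ψ.integrable.const_mul _
      refine this.congr (Eventually.of_forall fun x => ?_)
      have : (-2 * Real.pi * Complex.I : ℂ) ≠ 0 := by simp [Real.pi_ne_zero]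
      simp only [hψ, HasCompactSupport.toSchwartzMap_toFun, Complex.real_smul]
      field_simp
  have hparts := integral_mul_deriv_eq_deriv_mul_of_integrable (A := ℂ) (u := (𝓕 χ : 𝓢(ℝ, ℂ)))
    (v := f) (u' := deriv (𝓕 χ : 𝓢(ℝ, ℂ))) (v' := deriv f)
    (fun x _ => ((𝓕 χ : 𝓢(ℝ, ℂ)).differentiable x).hasDerivAt) (fun x _ => (hd x).hasDerivAt)
    ((memLp_two_schwartz _).integrable_mul hf')
    (by rw [hder]; exact (memLp_two_schwartz _).integrable_mul hf)
    ((memLp_two_schwartz _).integrable_mul hf)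
  rw [integral_mul_fourierL2 hf', hparts, hder, ← integral_mul_fourierL2 hf, ← integral_neg]
  refine integral_congr_ae (Eventually.of_forall fun x => ?_)
  simp only [hψ, HasCompactSupport.toSchwartzMap_toFun]
  ring

end FourierBasics
-- Measurability of the representative itself, not only up to null sets, is what the convolution
-- estimate requires.
lemma stronglyMeasurable_fourierL2 (f : ℝ → ℂ) : StronglyMeasurable (fourierL2 f) := by
  by_cases h : MemLp f 2 (volume : Measure ℝ)
  · rw [fourierL2_of_memLp h]
    exact Lp.stronglyMeasurable _
  · simp only [fourierL2, h, dite_false]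
    exact stronglyMeasurable_zero

/-! ### Weighted `L²` norms on the Fourier side -/

/-- The symbol `iη = 2πiξ` of the derivative. -/
noncomputable def freq (ξ : ℝ) : ℂ := 2 * Real.pi * Complex.I * ξ

lemma continuous_freq : Continuous freq := by unfold freq; fun_prop

lemma norm_freq (ξ : ℝ) : ‖freq ξ‖ = |2 * Real.pi * ξ| := by
  simp [freq, abs_mul]

lemma norm_freq_sq (ξ : ℝ) : ‖freq ξ‖ ^ 2 = symb ξ - 1 := by
  rw [norm_freq, sq_abs, symb]; ring

lemma one_le_symb (ξ : ℝ) : 1 ≤ symb ξ := by unfold symb; nlinarith [sq_nonneg (2 * Real.pi * ξ)]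

lemma continuous_symb : Continuous symb := by unfold symb; fun_prop

lemma norm_freq_le (ξ : ℝ) : ‖freq ξ‖ ≤ symb ξ ^ (1 / 2 : ℝ) := by
  rw [← Real.sqrt_eq_rpow]
  apply Real.le_sqrt_of_sq_le
  rw [norm_freq_sq]
  linarith

lemma symb_rpow_half_le (ξ : ℝ) : symb ξ ^ (1 / 2 : ℝ) ≤ 1 + ‖freq ξ‖ := by
  rw [← Real.sqrt_eq_rpow]
  apply Real.sqrt_le_iff.2 ⟨by positivity, ?_⟩
  nlinarith [norm_freq_sq ξ, norm_nonneg (freq ξ)]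

/-- The `L²` norm with weight `(1 + η²)^(s/2)`. -/
noncomputable def weightedENorm (s : ℝ) (φ : ℝ → ℂ) : ℝ≥0∞ :=
  eLpNorm (fun ξ : ℝ => ((symb ξ ^ (s / 2) : ℝ) : ℂ) * φ ξ) 2 volume

lemma sobolevENorm_of_memLp {f : ℝ → ℂ} (hf : MemLp f 2 (volume : Measure ℝ)) (s : ℝ) :
    sobolevENorm s f = weightedENorm s (fourierL2 f) := by
  simp [sobolevENorm, hf, weightedENorm]

lemma weightedENorm_congr_ae {s : ℝ} {φ ψ : ℝ → ℂ} (h : φ =ᵐ[volume] ψ) :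
    weightedENorm s φ = weightedENorm s ψ := by
  refine eLpNorm_congr_ae ?_
  filter_upwards [h] with ξ hξ
  rw [hξ]

lemma norm_symb_rpow_mul (s : ℝ) (φ : ℝ → ℂ) (ξ : ℝ) :
    ‖((symb ξ ^ (s / 2) : ℝ) : ℂ) * φ ξ‖ = symb ξ ^ (s / 2) * ‖φ ξ‖ := by
  rw [norm_mul, Complex.norm_real, Real.norm_of_nonneg (Real.rpow_nonneg (symb_pos ξ).le _)]

lemma weightedENorm_mono {s t : ℝ} {φ ψ : ℝ → ℂ}
    (h : ∀ ξ, symb ξ ^ (s / 2) * ‖φ ξ‖ ≤ symb ξ ^ (t / 2) * ‖ψ ξ‖) :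
    weightedENorm s φ ≤ weightedENorm t ψ := by
  refine eLpNorm_mono fun ξ => ?_
  rw [norm_symb_rpow_mul, norm_symb_rpow_mul]
  exact h ξ

lemma weightedENorm_mono_exponent {s t : ℝ} (h : s ≤ t) (φ : ℝ → ℂ) :
    weightedENorm s φ ≤ weightedENorm t φ :=
  weightedENorm_mono fun ξ => by
    gcongr
    exact one_le_symb ξ

lemma eLpNorm_two_le_weightedENorm {s : ℝ} (hs : 0 ≤ s) (φ : ℝ → ℂ) :
    eLpNorm φ 2 volume ≤ weightedENorm s φ := by
  refine eLpNorm_mono fun ξ => ?_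
  rw [norm_symb_rpow_mul]
  exact le_mul_of_one_le_left (norm_nonneg _) (Real.one_le_rpow (one_le_symb ξ) (by positivity))

/-- The norm of `(1 + η²)^(-1/2)` in `L²`, the constant of the embedding of `H¹` into the
functions with integrable Fourier transform. -/
noncomputable def sobolevConst : ℝ≥0∞ :=
  eLpNorm (fun ξ : ℝ => ((symb ξ ^ (-1 / 2 : ℝ) : ℝ) : ℂ)) 2 volume

lemma memLp_symb_rpow_neg_half :
    MemLp (fun ξ : ℝ => ((symb ξ ^ (-1 / 2 : ℝ) : ℝ) : ℂ)) 2 (volume : Measure ℝ) := by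
  rw [memLp_two_iff_integrable_sq_norm (measurable_symb_rpow _).aestronglyMeasurable]
  have h : ∀ ξ : ℝ, ‖((symb ξ ^ (-1 / 2 : ℝ) : ℝ) : ℂ)‖ ^ 2 = (1 + (2 * Real.pi * ξ) ^ 2)⁻¹ := by
    intro ξ
    rw [Complex.norm_real, Real.norm_of_nonneg (Real.rpow_nonneg (symb_pos ξ).le _),
      ← Real.rpow_natCast, ← Real.rpow_mul (symb_pos ξ).le]
    norm_num
    rw [Real.rpow_neg_one, symb]
  simp only [h]
  exact integrable_inv_one_add_sq.comp_mul_left' (by positivity)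

lemma sobolevConst_lt_top : sobolevConst < ⊤ := memLp_symb_rpow_neg_half.eLpNorm_lt_top

/-- Cauchy–Schwarz for `φ = (1+η²)^(-1/2) · (1+η²)^(1/2) φ`, the first factor being square
integrable on the line. -/
lemma eLpNorm_one_le_weightedENorm {s : ℝ} (hs : 1 ≤ s) {φ : ℝ → ℂ}
    (hφ : AEStronglyMeasurable φ volume) :
    eLpNorm φ 1 volume ≤ sobolevConst * weightedENorm s φ := by
  refine le_trans ?_ (mul_le_mul_right (weightedENorm_mono_exponent hs φ) _)
  have h := eLpNorm_smul_le_mul_eLpNorm (p := 2) (q := 2) (r := 1) (μ := (volume : Measure ℝ))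
    (f := fun ξ : ℝ => ((symb ξ ^ (1 / 2 : ℝ) : ℝ) : ℂ) * φ ξ)
    (φ := fun ξ : ℝ => ((symb ξ ^ (-1 / 2 : ℝ) : ℝ) : ℂ))
    ((measurable_symb_rpow _).aestronglyMeasurable.mul hφ)
    (measurable_symb_rpow _).aestronglyMeasurable
  refine le_trans (le_of_eq ?_) h
  congr 1
  ext ξ
  rw [Pi.smul_apply', smul_eq_mul, ← mul_assoc, ← Complex.ofReal_mul, ← Real.rpow_add (symb_pos ξ)]
  norm_num

lemma integrable_of_weightedENorm_lt_top {s : ℝ} (hs : 1 ≤ s) {φ : ℝ → ℂ}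
    (hφ : AEStronglyMeasurable φ volume) (h : weightedENorm s φ < ⊤) : Integrable φ :=
  memLp_one_iff_integrable.1 ⟨hφ, (eLpNorm_one_le_weightedENorm hs hφ).trans_lt
    (ENNReal.mul_lt_top sobolevConst_lt_top h)⟩

lemma weightedENorm_one_lt_top {φ : ℝ → ℂ} (h0 : MemLp φ 2 (volume : Measure ℝ))
    (h1 : MemLp (fun ξ => freq ξ * φ ξ) 2 (volume : Measure ℝ)) : weightedENorm 1 φ < ⊤ := by
  refine lt_of_le_of_lt (b := eLpNorm (fun ξ => ‖φ ξ‖ + ‖freq ξ * φ ξ‖) 2 volume) ?_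
    (h0.norm.add h1.norm).eLpNorm_lt_top
  refine eLpNorm_mono fun ξ => ?_
  rw [norm_symb_rpow_mul, Real.norm_of_nonneg (by positivity), norm_mul]
  calc _ ≤ (1 + ‖freq ξ‖) * ‖φ ξ‖ := by gcongr; exact symb_rpow_half_le ξ
    _ = _ := by ring

/-! ### The space `H^∞` -/

/-- A smooth function all of whose derivatives are square integrable. -/
structure HInf (f : ℝ → ℂ) : Prop where
  contDiff : ContDiff ℝ ∞ f
  memLp_iteratedDeriv : ∀ k, MemLp (iteratedDeriv k f) 2 (volume : Measure ℝ)

namespace HInf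

variable {f g : ℝ → ℂ}

lemma memLp (hf : HInf f) : MemLp f 2 (volume : Measure ℝ) := by
  simpa using hf.memLp_iteratedDeriv 0

lemma differentiable (hf : HInf f) : Differentiable ℝ f := hf.contDiff.differentiable (by simp)

lemma iteratedDeriv (hf : HInf f) (k : ℕ) : HInf (iteratedDeriv k f) where
  contDiff := hf.contDiff.iterate_deriv k |> fun h => by rwa [iteratedDeriv_eq_iterate]
  memLp_iteratedDeriv j := by
    have : _root_.iteratedDeriv j (_root_.iteratedDeriv k f) = _root_.iteratedDeriv (j + k) f := by
      simp only [iteratedDeriv_eq_iterate, Function.iterate_add_apply]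
    rw [this]
    exact hf.memLp_iteratedDeriv _

lemma deriv (hf : HInf f) : HInf (deriv f) := by
  simpa [iteratedDeriv_one] using hf.iteratedDeriv 1

lemma fourierL2_iteratedDeriv (hf : HInf f) (k : ℕ) :
    fourierL2 (_root_.iteratedDeriv k f) =ᵐ[volume] fun ξ => freq ξ ^ k * fourierL2 f ξ := by
  induction k with
  | zero => simp
  | succ k ih =>
    rw [iteratedDeriv_succ]
    have hk := hf.iteratedDeriv k
    filter_upwards [fourierL2_deriv hk.differentiable hk.memLp hk.deriv.memLp, ih] with ξ h1 h2
    rw [h1, h2, pow_succ, freq]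
    ring

lemma memLp_freq_pow_mul (hf : HInf f) (k : ℕ) :
    MemLp (fun ξ => freq ξ ^ k * fourierL2 f ξ) 2 (volume : Measure ℝ) :=
  (memLp_congr_ae (hf.fourierL2_iteratedDeriv k)).1 (memLp_fourierL2 _)

lemma weightedENorm_one_lt_top (hf : HInf f) : weightedENorm 1 (fourierL2 f) < ⊤ :=
  GenCH.weightedENorm_one_lt_top (memLp_fourierL2 f) (by simpa using hf.memLp_freq_pow_mul 1)

lemma integrable_fourierL2 (hf : HInf f) : Integrable (fourierL2 f) :=
  integrable_of_weightedENorm_lt_top le_rfl (aestronglyMeasurable_fourierL2 f)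
    hf.weightedENorm_one_lt_top

lemma eq_fourierInv (hf : HInf f) : f = 𝓕⁻ (fourierL2 f) :=
  eq_fourierInv_fourierL2 hf.contDiff.continuous hf.memLp hf.integrable_fourierL2

end HInf

/-! ### Smooth functions built from rapidly decaying Fourier data -/

section Synthesis

variable {φ : ℝ → ℂ}

/-- Square integrability of the next power of the frequency supplies the `H¹` weight, and hence
integrability. -/
lemma integrable_freq_pow_mul
    (hφ : ∀ k : ℕ, MemLp (fun ξ => freq ξ ^ k * φ ξ) 2 (volume : Measure ℝ)) (k : ℕ) :
    Integrable (fun ξ => freq ξ ^ k * φ ξ) := by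
  refine integrable_of_weightedENorm_lt_top le_rfl (hφ k).1
    (weightedENorm_one_lt_top (hφ k) ?_)
  convert hφ (k + 1) using 2
  ring

lemma iteratedDeriv_fourierInv
    (hφ : ∀ k : ℕ, MemLp (fun ξ => freq ξ ^ k * φ ξ) 2 (volume : Measure ℝ)) (k : ℕ) :
    ContDiff ℝ ∞ (𝓕⁻ φ) ∧ iteratedDeriv k (𝓕⁻ φ) = 𝓕⁻ (fun ξ => freq ξ ^ k * φ ξ) := by
  -- The inverse transform is the Fourier transform of the reflected function; its integrable
  -- moments allow differentiation under the integral.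
  have hint : ∀ n : ℕ, Integrable (fun x : ℝ => x ^ n • φ (-x)) := by
    intro n
    have h := ((integrable_freq_pow_mul hφ n).comp_neg).const_mul
      ((-2 * Real.pi * Complex.I : ℂ)⁻¹ ^ n)
    refine h.congr (Eventually.of_forall fun x => ?_)
    have h0 : (-2 * Real.pi * Complex.I : ℂ) ≠ 0 := by simp [Real.pi_ne_zero]
    have : freq (-x) = (-2 * Real.pi * Complex.I : ℂ) * x := by simp [freq]
    simp only [this, Complex.real_smul, Complex.ofReal_pow]
    rw [← mul_assoc, ← mul_pow, inv_mul_cancel_left₀ h0]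
  rw [Real.fourierInv_eq_fourier_comp_neg, Real.fourierInv_eq_fourier_comp_neg]
  constructor
  · refine Real.contDiff_fourier (N := ⊤) fun n _ => ?_
    have := (hint n).norm
    simpa [norm_smul] using this
  · rw [Real.iteratedDeriv_fourier (N := ⊤) (fun n _ => hint n) le_top]
    congr 1
    ext x
    simp [freq]

lemma hInf_fourierInv
    (hφ : ∀ k : ℕ, MemLp (fun ξ => freq ξ ^ k * φ ξ) 2 (volume : Measure ℝ)) : HInf (𝓕⁻ φ) where
  contDiff := (iteratedDeriv_fourierInv hφ 0).1
  memLp_iteratedDeriv k := by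
    rw [(iteratedDeriv_fourierInv hφ k).2]
    exact (memLp_fourierInv_and_fourierL2 (integrable_freq_pow_mul hφ k) (hφ k)).1

lemma fourierL2_fourierInv
    (hφ : ∀ k : ℕ, MemLp (fun ξ => freq ξ ^ k * φ ξ) 2 (volume : Measure ℝ)) :
    fourierL2 (𝓕⁻ φ) =ᵐ[volume] φ :=
  (memLp_fourierInv_and_fourierL2 (by simpa using integrable_freq_pow_mul hφ 0)
    (by simpa using hφ 0)).2

end Synthesis

/-! ### Sobolev embedding -/

lemma enorm_fourierInv_le (φ : ℝ → ℂ) (x : ℝ) : ‖(𝓕⁻ φ) x‖ₑ ≤ eLpNorm φ 1 volume := by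
  rw [Real.fourierInv_eq, eLpNorm_one_eq_lintegral_enorm]
  refine (enorm_integral_le_lintegral_enorm _).trans (le_of_eq ?_)
  congr 1
  ext v
  rw [Circle.smul_def, smul_eq_mul, enorm_mul, ← ofReal_norm ((𝐞 (inner ℝ v x) : Circle) : ℂ),
    Circle.norm_coe, ENNReal.ofReal_one, one_mul]

/-- The supremum of `f` is at most the `L¹` norm of its transform, which the weight `(1+η²)^(1/2)`
controls. -/
lemma HInf.enorm_le {f : ℝ → ℂ} (hf : HInf f) {s : ℝ} (hs : 1 ≤ s) (x : ℝ) :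
    ‖f x‖ₑ ≤ sobolevConst * sobolevENorm s f := by
  rw [sobolevENorm_of_memLp hf.memLp]
  conv_lhs => rw [hf.eq_fourierInv]
  exact (enorm_fourierInv_le _ x).trans
    (eLpNorm_one_le_weightedENorm hs (aestronglyMeasurable_fourierL2 f))

lemma sobolevENorm_mono_exponent {s t : ℝ} (h : s ≤ t) (f : ℝ → ℂ) :
    sobolevENorm s f ≤ sobolevENorm t f := by
  by_cases hf : MemLp f 2 (volume : Measure ℝ)
  · rw [sobolevENorm_of_memLp hf, sobolevENorm_of_memLp hf]
    exact weightedENorm_mono_exponent h _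
  · simp [sobolevENorm, hf]

lemma HInf.sobolevENorm_deriv_le {f : ℝ → ℂ} (hf : HInf f) (s : ℝ) :
    sobolevENorm s (_root_.deriv f) ≤ sobolevENorm (s + 1) f := by
  rw [sobolevENorm_of_memLp hf.memLp, sobolevENorm_of_memLp hf.deriv.memLp]
  have h := hf.fourierL2_iteratedDeriv 1
  rw [iteratedDeriv_one] at h
  rw [weightedENorm_congr_ae h]
  refine weightedENorm_mono fun ξ => ?_
  rw [norm_mul, pow_one, ← mul_assoc, add_div, Real.rpow_add (symb_pos ξ)]
  have := symb_pos ξ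
  gcongr
  exact norm_freq_le ξ

/-! ### Young's inequality and the algebra property of the Sobolev norms -/

/-- Young's inequality `L¹ * L² → L²`: Cauchy–Schwarz applied to `a b = a^(1/2) (a b²)^(1/2)`, then
Tonelli and translation invariance. Working in `ℝ≥0∞` avoids all integrability conditions. -/
lemma eLpNorm_lintegral_mul_sub_le {a b : ℝ → ℝ≥0∞} (ha : Measurable a) (hb : Measurable b) :
    eLpNorm (fun x => ∫⁻ t, a t * b (x - t)) 2 volume ≤ (∫⁻ t, a t) * eLpNorm b 2 volume := by
  have hb2 : ∀ x : ℝ, Measurable fun t => b (x - t) := fun x =>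
    hb.comp (measurable_const.sub measurable_id)
  have hcs : ∀ x : ℝ, (∫⁻ t, a t * b (x - t)) ^ (2 : ℝ)
      ≤ (∫⁻ t, a t) * ∫⁻ t, a t * b (x - t) ^ (2 : ℝ) := by
    intro x
    have h := ENNReal.lintegral_mul_norm_pow_le (μ := (volume : Measure ℝ)) (p := 1 / 2)
      (q := 1 / 2) (f := a) (g := fun t => a t * b (x - t) ^ (2 : ℝ)) ha.aemeasurable
      (ha.mul ((hb2 x).pow_const _)).aemeasurable (by norm_num) (by norm_num) (by norm_num)
    have e : ∀ t, a t ^ (1 / 2 : ℝ) * (a t * b (x - t) ^ (2 : ℝ)) ^ (1 / 2 : ℝ)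
        = a t * b (x - t) := by
      intro t
      rw [ENNReal.mul_rpow_of_nonneg _ _ (by norm_num), ← mul_assoc,
        ← ENNReal.rpow_add_of_nonneg _ _ (by norm_num) (by norm_num), ← ENNReal.rpow_mul]
      norm_num
    simp only [e] at h
    calc _ ≤ _ := ENNReal.rpow_le_rpow h (by norm_num : (0 : ℝ) ≤ 2)
      _ = _ := by
        rw [ENNReal.mul_rpow_of_nonneg _ _ (by norm_num), ← ENNReal.rpow_mul, ← ENNReal.rpow_mul]
        norm_num
  have hF : ∫⁻ x, ∫⁻ t, a t * b (x - t) ^ (2 : ℝ)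
      = (∫⁻ t, a t) * ∫⁻ x, b x ^ (2 : ℝ) := by
    rw [lintegral_lintegral_swap]
    · have : ∀ t, ∫⁻ x, a t * b (x - t) ^ (2 : ℝ) = a t * ∫⁻ x, b x ^ (2 : ℝ) := by
        intro t
        have hm : Measurable fun x => b (x - t) ^ (2 : ℝ) :=
          (hb.comp (measurable_id.sub measurable_const)).pow_const _
        rw [lintegral_const_mul _ hm,
          lintegral_sub_right_eq_self (fun x => b x ^ (2 : ℝ)) t]
      simp only [this]
      rw [lintegral_mul_const _ ha]
    · exact ((ha.comp measurable_snd).mul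
        ((hb.comp (measurable_fst.sub measurable_snd)).pow_const _)).aemeasurable
  rw [eLpNorm_eq_lintegral_rpow_enorm_toReal (by norm_num) (by norm_num),
    eLpNorm_eq_lintegral_rpow_enorm_toReal (by norm_num) (by norm_num)]
  simp only [enorm_eq_self, ENNReal.toReal_ofNat]
  calc _ ≤ ((∫⁻ t, a t) * ((∫⁻ t, a t) * ∫⁻ x, b x ^ (2 : ℝ))) ^ (1 / 2 : ℝ) := by
        refine ENNReal.rpow_le_rpow ?_ (by norm_num)
        rw [← hF, ← lintegral_const_mul]
        · exact lintegral_mono hcs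
        · exact Measurable.lintegral_prod_right ((ha.comp measurable_snd).mul
            ((hb.comp (measurable_fst.sub measurable_snd)).pow_const _))
    _ = _ := by
      rw [← mul_assoc, ENNReal.mul_rpow_of_nonneg _ _ (by norm_num), ← sq, ← ENNReal.rpow_natCast,
        ← ENNReal.rpow_mul]
      norm_num

/-- The symbol at a sum is at most four times the larger of the two symbols, and `4^(s/2) = 2^s`.
This lets the Sobolev weight of a convolution fall on one factor at a time. -/
lemma symb_add_rpow_le {s : ℝ} (hs : 0 ≤ s) (x y : ℝ) :
    symb (x + y) ^ (s / 2) ≤ 2 ^ s * (symb x ^ (s / 2) + symb y ^ (s / 2)) := by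
  have hm : symb (x + y) ≤ 4 * max (symb x) (symb y) := by
    have h1 : symb (x + y) ≤ 2 * (symb x + symb y) := by
      unfold symb
      nlinarith [sq_nonneg (2 * Real.pi * x - 2 * Real.pi * y)]
    have := le_max_left (symb x) (symb y)
    have := le_max_right (symb x) (symb y)
    linarith
  have h4 : (4 : ℝ) ^ (s / 2) = 2 ^ s := by
    rw [show (4 : ℝ) = 2 ^ (2 : ℝ) by norm_num, ← Real.rpow_mul (by norm_num)]
    congr 1
    ring
  have hx := symb_pos x
  have hy := symb_pos y
  calc symb (x + y) ^ (s / 2) ≤ (4 * max (symb x) (symb y)) ^ (s / 2) :=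
        Real.rpow_le_rpow (symb_pos _).le hm (by positivity)
    _ = 2 ^ s * max (symb x) (symb y) ^ (s / 2) := by
        rw [Real.mul_rpow (by norm_num) (le_max_of_le_left hx.le), h4]
    _ ≤ _ := by
        gcongr
        rcases max_choice (symb x) (symb y) with h | h <;> rw [h]
        · exact le_add_of_nonneg_right (by positivity)
        · exact le_add_of_nonneg_left (by positivity)

open scoped Convolution in
lemma weightedENorm_convolution_le {s : ℝ} (hs : 0 ≤ s) {φ ψ : ℝ → ℂ} (hφ : StronglyMeasurable φ)
    (hψ : StronglyMeasurable ψ) :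
    weightedENorm s (φ ⋆[ContinuousLinearMap.mul ℂ ℂ] ψ) ≤ ENNReal.ofReal (2 ^ s) *
      (eLpNorm ψ 1 volume * weightedENorm s φ + eLpNorm φ 1 volume * weightedENorm s ψ) := by
  set c := ENNReal.ofReal (2 ^ s) with hc
  set W : (ℝ → ℂ) → ℝ → ℂ := fun φ ξ => ((symb ξ ^ (s / 2) : ℝ) : ℂ) * φ ξ with hW
  have hWm : ∀ {φ : ℝ → ℂ}, StronglyMeasurable φ → Measurable fun ξ => ‖W φ ξ‖ₑ :=
    fun h => ((measurable_symb_rpow _).mul h.measurable).enorm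
  have hpt : ∀ x, ‖W (φ ⋆[ContinuousLinearMap.mul ℂ ℂ] ψ) x‖ₑ ≤
      (∫⁻ t, (c * ‖ψ t‖ₑ) * ‖W φ (x - t)‖ₑ) + ∫⁻ t, (c * ‖φ t‖ₑ) * ‖W ψ (x - t)‖ₑ := by
    intro x
    -- The reflection `t ↦ x - t` brings both terms to the same variables, so that they can be
    -- compared with the convolution integrand pointwise.
    have h1 : ∫⁻ t, (c * ‖ψ t‖ₑ) * ‖W φ (x - t)‖ₑ = ∫⁻ t, (c * ‖ψ (x - t)‖ₑ) * ‖W φ t‖ₑ := by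
      rw [← lintegral_sub_left_eq_self (fun t => (c * ‖ψ t‖ₑ) * ‖W φ (x - t)‖ₑ) x]
      simp
    have h2 : Measurable fun t => (c * ‖ψ (x - t)‖ₑ) * ‖W φ t‖ₑ := (((hψ.measurable.comp
      (measurable_const.sub measurable_id)).enorm).const_mul c).mul (hWm hφ)
    rw [h1, ← lintegral_add_left h2]
    calc ‖W (φ ⋆[ContinuousLinearMap.mul ℂ ℂ] ψ) x‖ₑ
        = ‖∫ t, ((symb x ^ (s / 2) : ℝ) : ℂ) * (φ t * ψ (x - t))‖ₑ := by
          rw [integral_const_mul]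
          rfl
      _ ≤ ∫⁻ t, ‖((symb x ^ (s / 2) : ℝ) : ℂ) * (φ t * ψ (x - t))‖ₑ :=
          enorm_integral_le_lintegral_enorm _
      _ ≤ _ := by
          refine lintegral_mono fun t => ?_
          have h := symb_add_rpow_le hs t (x - t)
          rw [add_sub_cancel] at h
          have p1 := Real.rpow_nonneg (symb_pos t).le (s / 2)
          have p2 := Real.rpow_nonneg (symb_pos (x - t)).le (s / 2)
          simp only [hW, hc, ← ofReal_norm, norm_mul, Complex.norm_real]
          rw [Real.norm_of_nonneg (Real.rpow_nonneg (symb_pos x).le _), Real.norm_of_nonneg p1,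
            Real.norm_of_nonneg p2, ← ENNReal.ofReal_mul (by positivity),
            ← ENNReal.ofReal_mul (by positivity), ← ENNReal.ofReal_mul (by positivity),
            ← ENNReal.ofReal_mul (by positivity), ← ENNReal.ofReal_add (by positivity)
            (by positivity)]
          refine ENNReal.ofReal_le_ofReal ?_
          calc _ ≤ (2 ^ s * (symb t ^ (s / 2) + symb (x - t) ^ (s / 2))) * (‖φ t‖ * ‖ψ (x - t)‖) := by
                gcongr
            _ = _ := by ring
  have hfin : ∀ {θ η : ℝ → ℂ}, StronglyMeasurable θ → StronglyMeasurable η →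
      eLpNorm (fun x => ∫⁻ t, (c * ‖θ t‖ₑ) * ‖W η (x - t)‖ₑ) 2 volume
        ≤ c * (eLpNorm θ 1 volume * weightedENorm s η) := by
    intro θ η hθ hη
    refine (eLpNorm_lintegral_mul_sub_le (hθ.measurable.enorm.const_mul c) (hWm hη)).trans
      (le_of_eq ?_)
    rw [lintegral_const_mul _ hθ.measurable.enorm, eLpNorm_one_eq_lintegral_enorm, mul_assoc]
    congr 2
  have hmeas : ∀ {θ η : ℝ → ℂ}, StronglyMeasurable θ → StronglyMeasurable η →
      Measurable fun x => ∫⁻ t, (c * ‖θ t‖ₑ) * ‖W η (x - t)‖ₑ := by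
    intro θ η hθ hη
    refine Measurable.lintegral_prod_right ?_
    exact ((hθ.measurable.enorm.const_mul c).comp measurable_snd).mul
      ((hWm hη).comp (measurable_fst.sub measurable_snd))
  calc _ ≤ eLpNorm ((fun x => ∫⁻ t, (c * ‖ψ t‖ₑ) * ‖W φ (x - t)‖ₑ) +
        fun x => ∫⁻ t, (c * ‖φ t‖ₑ) * ‖W ψ (x - t)‖ₑ) 2 volume := eLpNorm_mono_enorm hpt
    _ ≤ _ := eLpNorm_add_le (hmeas hψ hφ).aestronglyMeasurable (hmeas hφ hψ).aestronglyMeasurable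
        (by norm_num)
    _ ≤ c * (eLpNorm ψ 1 volume * weightedENorm s φ) +
        c * (eLpNorm φ 1 volume * weightedENorm s ψ) := add_le_add (hfin hψ hφ) (hfin hφ hψ)
    _ = _ := (mul_add _ _ _).symm

open scoped Convolution in
lemma fourierInv_mul_fourierInv {φ ψ : ℝ → ℂ} (hφ : Integrable φ) (hψ : Integrable ψ) :
    𝓕⁻ φ * 𝓕⁻ ψ = 𝓕⁻ (φ ⋆[ContinuousLinearMap.mul ℂ ℂ] ψ) := by
  ext x
  rw [Pi.mul_apply, Real.fourierInv_eq_fourier_neg, Real.fourierInv_eq_fourier_neg,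
    Real.fourierInv_eq_fourier_neg, Real.fourier_mul_convolution_eq hφ hψ]

/-- The constant in the algebra property `‖f g‖ₛ ≤ C ‖f‖ₛ ‖g‖ₛ`. -/
noncomputable def algebraConst (s : ℝ) : ℝ≥0∞ := ENNReal.ofReal (2 ^ s) * (2 * sobolevConst)

lemma algebraConst_lt_top (s : ℝ) : algebraConst s < ⊤ :=
  ENNReal.mul_lt_top ENNReal.ofReal_lt_top (ENNReal.mul_lt_top (by simp) sobolevConst_lt_top)

open scoped Convolution in
-- The transform of the product is the convolution of the transforms. In each of the two terms the
-- unweighted `L¹` factor is absorbed by the Sobolev embedding, whence the `2 * sobolevConst`.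
lemma HInf.sobolevENorm_mul_le {f g : ℝ → ℂ} (hf : HInf f) (hg : HInf g) {s : ℝ} (hs : 1 ≤ s) :
    MemLp (f * g) 2 (volume : Measure ℝ) ∧
      sobolevENorm s (f * g) ≤ algebraConst s * (sobolevENorm s f * sobolevENorm s g) := by
  set φ := fourierL2 f
  set ψ := fourierL2 g
  have hfg : f * g = 𝓕⁻ (φ ⋆[ContinuousLinearMap.mul ℂ ℂ] ψ) := by
    rw [← fourierInv_mul_fourierInv hf.integrable_fourierL2 hg.integrable_fourierL2,
      ← hf.eq_fourierInv, ← hg.eq_fourierInv]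
  have hI : Integrable (φ ⋆[ContinuousLinearMap.mul ℂ ℂ] ψ) :=
    hf.integrable_fourierL2.integrable_convolution _ hg.integrable_fourierL2
  have hconv := fun {r : ℝ} (hr : 0 ≤ r) => weightedENorm_convolution_le hr
    (stronglyMeasurable_fourierL2 f) (stronglyMeasurable_fourierL2 g)
  -- The convolution estimate is used with exponent `1`, where the weighted norms of `H^∞` functions
  -- are already known to be finite.
  have h2 : MemLp (φ ⋆[ContinuousLinearMap.mul ℂ ℂ] ψ) 2 (volume : Measure ℝ) := by
    refine ⟨hI.1, (eLpNorm_two_le_weightedENorm zero_le_one _).trans_lt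
      ((hconv zero_le_one).trans_lt ?_)⟩
    exact ENNReal.mul_lt_top ENNReal.ofReal_lt_top (ENNReal.add_lt_top.2
      ⟨ENNReal.mul_lt_top (memLp_one_iff_integrable.2 hg.integrable_fourierL2).eLpNorm_lt_top
        hf.weightedENorm_one_lt_top,
      ENNReal.mul_lt_top (memLp_one_iff_integrable.2 hf.integrable_fourierL2).eLpNorm_lt_top
        hg.weightedENorm_one_lt_top⟩)
  obtain ⟨h3, h4⟩ := memLp_fourierInv_and_fourierL2 hI h2
  rw [hfg]
  refine ⟨h3, ?_⟩
  rw [sobolevENorm_of_memLp h3, weightedENorm_congr_ae h4, sobolevENorm_of_memLp hf.memLp,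
    sobolevENorm_of_memLp hg.memLp]
  refine (hconv (zero_le_one.trans hs)).trans ?_
  rw [algebraConst, mul_assoc]
  refine mul_le_mul_right ?_ _
  calc _ ≤ sobolevConst * weightedENorm s ψ * weightedENorm s φ
        + sobolevConst * weightedENorm s φ * weightedENorm s ψ := by
        gcongr
        · exact eLpNorm_one_le_weightedENorm hs (aestronglyMeasurable_fourierL2 g)
        · exact eLpNorm_one_le_weightedENorm hs (aestronglyMeasurable_fourierL2 f)
    _ = _ := by ring

/-! ### Closure properties of `H^∞` -/

namespace HInf

variable {f g : ℝ → ℂ}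

lemma contDiffAt (hf : HInf f) (n : ℕ) (x : ℝ) : ContDiffAt ℝ n f x :=
  (hf.contDiff.of_le (by exact_mod_cast le_top)).contDiffAt

lemma add (hf : HInf f) (hg : HInf g) : HInf (f + g) where
  contDiff := hf.contDiff.add hg.contDiff
  memLp_iteratedDeriv k := by
    have : _root_.iteratedDeriv k (f + g) =
        _root_.iteratedDeriv k f + _root_.iteratedDeriv k g := by
      ext x
      exact iteratedDeriv_add (hf.contDiffAt k x) (hg.contDiffAt k x)
    rw [this]
    exact (hf.memLp_iteratedDeriv k).add (hg.memLp_iteratedDeriv k)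

lemma smul (c : ℂ) (hf : HInf f) : HInf (c • f) where
  contDiff := contDiff_const.smul hf.contDiff
  memLp_iteratedDeriv k := by
    have : _root_.iteratedDeriv k (c • f) = c • _root_.iteratedDeriv k f := by
      ext x
      exact iteratedDeriv_const_smul_field c f
    rw [this]
    exact (hf.memLp_iteratedDeriv k).const_smul c

lemma neg (hf : HInf f) : HInf (-f) := by simpa using hf.smul (-1)

lemma iteratedDeriv_mul (hf : HInf f) (hg : HInf g) (k : ℕ) :
    _root_.iteratedDeriv k (f * g) = ∑ p ∈ Finset.HasAntidiagonal.antidiagonal k,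
      (k.choose p.1 : ℂ) • (_root_.iteratedDeriv p.1 f * _root_.iteratedDeriv p.2 g) := by
  ext x
  rw [_root_.iteratedDeriv_mul (hf.contDiffAt k x) (hg.contDiffAt k x),
    ← Finset.Nat.sum_antidiagonal_eq_sum_range_succ
      (fun i j => (k.choose i : ℂ) * _root_.iteratedDeriv i f x * _root_.iteratedDeriv j g x),
    Finset.sum_apply]
  simp [mul_assoc]

lemma mul (hf : HInf f) (hg : HInf g) : HInf (f * g) where
  contDiff := hf.contDiff.mul hg.contDiff
  memLp_iteratedDeriv k := by
    rw [hf.iteratedDeriv_mul hg]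
    refine memLp_finsetSum' _ fun p _ => MemLp.const_smul ?_ _
    exact ((hf.iteratedDeriv _).sobolevENorm_mul_le (hg.iteratedDeriv _) le_rfl).1

end HInf

/-! ### The operator `Λ⁻² ∂ₓ` -/

/-- The operator `Λ⁻² ∂ₓ`. -/
noncomputable def helmDeriv (g : ℝ → ℂ) : ℝ → ℂ := invHelmholtz (deriv g)

/-- The Fourier symbol of `Λ⁻² ∂ₓ`. -/
noncomputable def helmSymb (ξ : ℝ) : ℂ := (((symb ξ)⁻¹ : ℝ) : ℂ) * freq ξ

lemma norm_helmSymb (ξ : ℝ) : ‖helmSymb ξ‖ = (symb ξ)⁻¹ * ‖freq ξ‖ := by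
  rw [helmSymb, norm_mul, Complex.norm_real,
    Real.norm_of_nonneg (inv_nonneg.2 (symb_pos ξ).le)]

lemma norm_helmSymb_le_one (ξ : ℝ) : ‖helmSymb ξ‖ ≤ 1 := by
  rw [norm_helmSymb, inv_mul_le_one₀ (symb_pos ξ)]
  refine (norm_freq_le ξ).trans ?_
  simpa using Real.rpow_le_rpow_of_exponent_le (one_le_symb ξ) (by norm_num : (1 / 2 : ℝ) ≤ 1)

lemma symb_rpow_mul_norm_helmSymb_le (ξ : ℝ) : symb ξ ^ (1 / 2 : ℝ) * ‖helmSymb ξ‖ ≤ 1 := by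
  have h := symb_pos ξ
  rw [norm_helmSymb]
  calc _ ≤ symb ξ ^ (1 / 2 : ℝ) * ((symb ξ)⁻¹ * symb ξ ^ (1 / 2 : ℝ)) := by
        gcongr
        exact norm_freq_le ξ
    _ = (symb ξ)⁻¹ * (symb ξ ^ (1 / 2 : ℝ) * symb ξ ^ (1 / 2 : ℝ)) := by ring
    _ = 1 := by
        rw [← Real.rpow_add h]
        norm_num
        exact inv_mul_cancel₀ h.ne'

lemma continuous_helmSymb : Continuous helmSymb :=
  (Complex.continuous_ofReal.comp (continuous_symb.inv₀ fun ξ => (symb_pos ξ).ne')).mul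
    continuous_freq

namespace HInf

variable {f g : ℝ → ℂ}

lemma memLp_freq_pow_mul_helmSymb (hg : HInf g) (k : ℕ) :
    MemLp (fun ξ => freq ξ ^ k * (helmSymb ξ * fourierL2 g ξ)) 2 (volume : Measure ℝ) := by
  refine MemLp.of_le (hg.memLp_freq_pow_mul k) ?_ (Eventually.of_forall fun ξ => ?_)
  · exact ((continuous_freq.pow k).aestronglyMeasurable).mul
      (continuous_helmSymb.aestronglyMeasurable.mul (aestronglyMeasurable_fourierL2 g))
  · rw [norm_mul, norm_mul, norm_mul]
    gcongr
    exact mul_le_of_le_one_left (norm_nonneg _) (norm_helmSymb_le_one ξ)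

lemma helmDeriv_eq (hg : HInf g) :
    helmDeriv g = 𝓕⁻ (fun ξ => helmSymb ξ * fourierL2 g ξ) := by
  ext x
  refine Real.fourierInv_congr_ae ?_ x
  have h := hg.fourierL2_iteratedDeriv 1
  rw [iteratedDeriv_one] at h
  filter_upwards [h] with ξ hξ
  rw [hξ, helmSymb]
  ring

lemma helmDeriv (hg : HInf g) : HInf (helmDeriv g) := by
  rw [hg.helmDeriv_eq]
  exact hInf_fourierInv hg.memLp_freq_pow_mul_helmSymb

lemma fourierL2_helmDeriv (hg : HInf g) :
    fourierL2 (GenCH.helmDeriv g) =ᵐ[volume] fun ξ => helmSymb ξ * fourierL2 g ξ := by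
  rw [hg.helmDeriv_eq]
  exact fourierL2_fourierInv hg.memLp_freq_pow_mul_helmSymb

/-- `Λ⁻² ∂ₓ` is a multiplier of order `-1`, and it commutes with differentiation. -/
lemma sobolevENorm_iteratedDeriv_helmDeriv_le (hg : HInf g) (s : ℝ) (k : ℕ) :
    sobolevENorm (s + 1) (_root_.iteratedDeriv k (GenCH.helmDeriv g)) ≤
      sobolevENorm s (_root_.iteratedDeriv k g) := by
  rw [sobolevENorm_of_memLp (hg.iteratedDeriv k).memLp,
    sobolevENorm_of_memLp (hg.helmDeriv.iteratedDeriv k).memLp,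
    weightedENorm_congr_ae (hg.fourierL2_iteratedDeriv k),
    weightedENorm_congr_ae (hg.helmDeriv.fourierL2_iteratedDeriv k)]
  have : weightedENorm (s + 1) (fun ξ => freq ξ ^ k * fourierL2 (GenCH.helmDeriv g) ξ) =
      weightedENorm (s + 1) (fun ξ => freq ξ ^ k * (helmSymb ξ * fourierL2 g ξ)) := by
    refine weightedENorm_congr_ae ?_
    filter_upwards [hg.fourierL2_helmDeriv] with ξ hξ
    rw [hξ]
  rw [this]
  refine weightedENorm_mono fun ξ => ?_
  have h0 := symb_pos ξ
  rw [norm_mul, norm_mul, norm_mul, add_div, Real.rpow_add h0]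
  calc _ = symb ξ ^ (s / 2) * (‖freq ξ ^ k‖ * ((symb ξ ^ (1 / 2 : ℝ) * ‖helmSymb ξ‖) *
        ‖fourierL2 g ξ‖)) := by ring
    _ ≤ _ := by
      gcongr
      exact mul_le_of_le_one_left (norm_nonneg _) (symb_rpow_mul_norm_helmSymb_le ξ)

/-- Linearity is clear for the transforms; injectivity of the transform gives equality almost
everywhere, and continuity gives it everywhere. -/
lemma helmDeriv_add (hf : HInf f) (hg : HInf g) :
    GenCH.helmDeriv (f + g) = GenCH.helmDeriv f + GenCH.helmDeriv g := by
  refine (Continuous.ae_eq_iff_eq volume (hf.add hg).helmDeriv.contDiff.continuous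
    (hf.helmDeriv.add hg.helmDeriv).contDiff.continuous).1
    (fourierL2_injective (hf.add hg).helmDeriv.memLp (hf.helmDeriv.add hg.helmDeriv).memLp ?_)
  filter_upwards [(hf.add hg).fourierL2_helmDeriv, hf.fourierL2_helmDeriv, hg.fourierL2_helmDeriv,
    fourierL2_add hf.memLp hg.memLp, fourierL2_add hf.helmDeriv.memLp hg.helmDeriv.memLp]
    with ξ h1 h2 h3 h4 h5
  rw [h1, h5, h4, Pi.add_apply, Pi.add_apply, h2, h3, mul_add]

lemma helmDeriv_smul (c : ℂ) (hf : HInf f) :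
    GenCH.helmDeriv (c • f) = c • GenCH.helmDeriv f := by
  refine (Continuous.ae_eq_iff_eq volume (hf.smul c).helmDeriv.contDiff.continuous
    (hf.helmDeriv.smul c).contDiff.continuous).1
    (fourierL2_injective (hf.smul c).helmDeriv.memLp (hf.helmDeriv.smul c).memLp ?_)
  filter_upwards [(hf.smul c).fourierL2_helmDeriv, hf.fourierL2_helmDeriv,
    fourierL2_smul c hf.memLp, fourierL2_smul c hf.helmDeriv.memLp] with ξ h1 h2 h3 h4
  rw [h1, h4, h3, Pi.smul_apply, Pi.smul_apply, h2, smul_eq_mul, smul_eq_mul]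
  ring

end HInf

lemma conj_fourierInv (φ : ℝ → ℂ) (x : ℝ) :
    (starRingEnd ℂ) ((𝓕⁻ φ) x) = (𝓕⁻ fun ξ => (starRingEnd ℂ) (φ (-ξ))) x := by
  rw [Real.fourierInv_eq', Real.fourierInv_eq', ← integral_conj, ← integral_neg_eq_self]
  congr 1
  ext ξ
  simp [← Complex.exp_conj, map_ofNat (starRingEnd ℂ) 2]

/-- A function is real exactly when its transform is Hermitian, `φ(ξ) = conj φ(-ξ)`. The symbol of
`Λ⁻² ∂ₓ` is Hermitian, being a real even factor times an imaginary odd one, so the product is again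
Hermitian. -/
lemma HInf.helmDeriv_im_eq_zero {g : ℝ → ℂ} (hg : HInf g) (hr : ∀ x, (g x).im = 0) (x : ℝ) :
    (GenCH.helmDeriv g x).im = 0 := by
  set φ := fourierL2 g
  have hφi := hg.integrable_fourierL2
  have hφ2 := memLp_fourierL2 g
  have hstar : g = 𝓕⁻ fun ξ => (starRingEnd ℂ) (φ (-ξ)) := by
    ext y
    rw [← conj_fourierInv, ← hg.eq_fourierInv, Complex.conj_eq_iff_im.2 (hr y)]
  have hconj : MemLp (fun ξ => (starRingEnd ℂ) (φ (-ξ))) 2 (volume : Measure ℝ) :=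
    (hφ2.comp_measurePreserving (Measure.measurePreserving_neg volume)).star
  have hae : φ =ᵐ[volume] fun ξ => (starRingEnd ℂ) (φ (-ξ)) := by
    have h := (memLp_fourierInv_and_fourierL2 (φ := fun ξ => (starRingEnd ℂ) (φ (-ξ)))
      ((LinearIsometryEquiv.integrable_comp_iff Complex.conjLIE).2 hφi.comp_neg) hconj).2
    rwa [← hstar] at h
  rw [← Complex.conj_eq_iff_im, hg.helmDeriv_eq, conj_fourierInv]
  refine Real.fourierInv_congr_ae ?_ x
  filter_upwards [hae] with ξ hξ
  rw [map_mul, ← hξ]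
  congr 1
  simp [helmSymb, freq, symb, map_ofNat (starRingEnd ℂ) 2]

/-! ### Two elementary inequalities -/

lemma sum_range_inv_sq_le_two (n : ℕ) :
    ∑ j ∈ Finset.range n, 1 / ((j : ℝ) + 1) ^ 2 ≤ 2 := by
  -- The correction `-1/(n+1)` makes the induction telescope.
  have h : ∀ n : ℕ, ∑ j ∈ Finset.range (n + 1), 1 / ((j : ℝ) + 1) ^ 2 ≤ 2 - 1 / ((n : ℝ) + 1) := by
    intro n
    induction n with
    | zero => norm_num
    | succ n ih =>
      rw [Finset.sum_range_succ]
      have : 1 / (((n + 1 : ℕ) : ℝ) + 1) ^ 2 ≤ 1 / ((n : ℝ) + 1) - 1 / (((n + 1 : ℕ) : ℝ) + 1) := by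
        push_cast
        rw [div_sub_div _ _ (by positivity) (by positivity),
          div_le_div_iff₀ (by positivity) (by positivity)]
        nlinarith [(Nat.cast_nonneg n : (0 : ℝ) ≤ n)]
      linarith
  calc _ ≤ ∑ j ∈ Finset.range (n + 1), 1 / ((j : ℝ) + 1) ^ 2 :=
        Finset.sum_le_sum_of_subset_of_nonneg (Finset.range_mono (Nat.le_succ n))
          fun _ _ _ => by positivity
    _ ≤ 2 - 1 / ((n : ℝ) + 1) := h n
    _ ≤ 2 := by linarith [show (0 : ℝ) ≤ 1 / ((n : ℝ) + 1) by positivity]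

/-- For `i + j = k` one has `(k+1)² ≤ 2((i+1)² + (j+1)²)`, which splits the product into two single
sums, each at most `2`; so `8 = 2 (2 + 2)`. This stability of `1/(k+1)²` under convolution is used
twice: in `x` for the Leibniz rule, and in `t` for the Taylor coefficients. -/
lemma sum_antidiagonal_inv_sq_le (k : ℕ) :
    ∑ p ∈ Finset.HasAntidiagonal.antidiagonal k,
      1 / ((p.1 : ℝ) + 1) ^ 2 * (1 / ((p.2 : ℝ) + 1) ^ 2) ≤ 8 * (1 / ((k : ℝ) + 1) ^ 2) := by
  have hk : ∀ p ∈ Finset.HasAntidiagonal.antidiagonal k,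
      1 / ((p.1 : ℝ) + 1) ^ 2 * (1 / ((p.2 : ℝ) + 1) ^ 2) ≤
        2 / ((k : ℝ) + 1) ^ 2 * (1 / ((p.1 : ℝ) + 1) ^ 2 + 1 / ((p.2 : ℝ) + 1) ^ 2) := by
    rintro ⟨i, j⟩ hp
    have hij : i + j = k := Finset.HasAntidiagonal.mem_antidiagonal.1 hp
    subst hij
    push_cast
    rw [div_mul_div_comm, div_add_div _ _ (by positivity) (by positivity), div_mul_div_comm,
      div_le_div_iff₀ (by positivity) (by positivity)]
    have hi : (0 : ℝ) ≤ i := Nat.cast_nonneg i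
    have hj : (0 : ℝ) ≤ j := Nat.cast_nonneg j
    have h : ((i : ℝ) + j + 1) ^ 2 ≤ 2 * (((j : ℝ) + 1) ^ 2 + ((i : ℝ) + 1) ^ 2) := by
      nlinarith [sq_nonneg ((i : ℝ) - j)]
    have := mul_le_mul_of_nonneg_right h
      (by positivity : (0 : ℝ) ≤ (((i : ℝ) + 1) ^ 2 * ((j : ℝ) + 1) ^ 2))
    linarith
  refine (Finset.sum_le_sum hk).trans ?_
  rw [← Finset.mul_sum, Finset.sum_add_distrib]
  have e1 := Finset.Nat.sum_antidiagonal_eq_sum_range_succ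
    (fun i _ : ℕ => 1 / ((i : ℝ) + 1) ^ 2) k
  have e2 := Finset.Nat.sum_antidiagonal_swap (n := k) (f := fun p => 1 / ((p.1 : ℝ) + 1) ^ 2)
  simp only [Prod.fst_swap] at e1 e2
  rw [e2, e1]
  have h2 := sum_range_inv_sq_le_two k.succ
  calc _ ≤ 2 / ((k : ℝ) + 1) ^ 2 * (2 + 2) := by gcongr
    _ = _ := by ring

/-- Convexity: the graph of `x^(k+1)` lies above its tangent at `δ`. -/
lemma succ_mul_pow_mul_sub_le {δ δ' : ℝ} (h0 : 0 ≤ δ) (h : δ ≤ δ') (k : ℕ) :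
    (k + 1) * δ ^ k * (δ' - δ) + δ ^ (k + 1) ≤ δ' ^ (k + 1) := by
  induction k with
  | zero => simp
  | succ k ih =>
    have h1 : 0 ≤ ((k : ℝ) + 1) * δ ^ k * (δ' - δ) :=
      mul_nonneg (by positivity) (sub_nonneg.2 h)
    have h2 := mul_le_mul_of_nonneg_left ih (h0.trans h)
    have h3 := mul_le_mul_of_nonneg_right h h1
    push_cast
    rw [pow_succ δ' (k + 1), pow_succ δ (k + 1)]
    rw [pow_succ δ k] at h2 ⊢
    nlinarith

/-! ### Estimates in the norms `‖·‖_(δ,s)` -/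

/-- The coefficients in the definition of `‖·‖_(δ,s)`. -/
noncomputable def coeffE (δ : ℝ) (k : ℕ) : ℝ := δ ^ k * ((k : ℝ) + 1) ^ 2 / (k.factorial : ℝ)

lemma coeffE_pos {δ : ℝ} (h : 0 < δ) (k : ℕ) : 0 < coeffE δ k := by
  unfold coeffE
  have := k.factorial_pos
  positivity

lemma coeffE_mul_sobolevENorm_le (δ s : ℝ) (f : ℝ → ℂ) (k : ℕ) :
    ENNReal.ofReal (coeffE δ k) * sobolevENorm s (iteratedDeriv k f) ≤ eNormE δ s f :=
  le_iSup (fun k : ℕ => ENNReal.ofReal (coeffE δ k) * sobolevENorm s (iteratedDeriv k f)) k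

lemma eNormE_le_iff {δ s : ℝ} {f : ℝ → ℂ} {B : ℝ≥0∞} : eNormE δ s f ≤ B ↔
    ∀ k, ENNReal.ofReal (coeffE δ k) * sobolevENorm s (iteratedDeriv k f) ≤ B :=
  iSup_le_iff

lemma eNormE_mono {δ δ' s : ℝ} (h0 : 0 ≤ δ) (h : δ ≤ δ') (f : ℝ → ℂ) :
    eNormE δ s f ≤ eNormE δ' s f :=
  eNormE_le_iff.2 fun k => le_trans (by unfold coeffE; gcongr) (coeffE_mul_sobolevENorm_le δ' s f k)

lemma eNormE_mono_exponent {δ s t : ℝ} (h : s ≤ t) (f : ℝ → ℂ) : eNormE δ s f ≤ eNormE δ t f :=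
  eNormE_le_iff.2 fun k => le_trans
    (mul_le_mul_right (sobolevENorm_mono_exponent h _) _) (coeffE_mul_sobolevENorm_le δ t f k)

/-- A Cauchy estimate: differentiation shifts `k` to `k + 1`, and up to the harmless factor
`((k+1)/(k+2))²` the ratio of the coefficients is `(k+1) δ^k / δ'^(k+1)`. The tangent inequality
bounds it by `1/(δ' - δ)`. -/
lemma eNormE_deriv_le {δ δ' : ℝ} (h0 : 0 ≤ δ) (h : δ < δ') (s : ℝ) (f : ℝ → ℂ) :
    eNormE δ s (deriv f) ≤ ENNReal.ofReal (1 / (δ' - δ)) * eNormE δ' s f := by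
  have hd : 0 < δ' - δ := sub_pos.2 h
  refine eNormE_le_iff.2 fun k => ?_
  rw [← iteratedDeriv_succ']
  refine le_trans ?_ (mul_le_mul_right (coeffE_mul_sobolevENorm_le δ' s f (k + 1)) _)
  rw [← mul_assoc, ← ENNReal.ofReal_mul (by positivity)]
  refine mul_le_mul_left (ENNReal.ofReal_le_ofReal ?_) _
  unfold coeffE
  have hk := Nat.cast_pos (α := ℝ).2 k.factorial_pos
  rw [Nat.factorial_succ]
  push_cast
  rw [div_mul_div_comm, div_le_div_iff₀ hk (by positivity)]
  have h1 := succ_mul_pow_mul_sub_le h0 h.le k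
  have h2 : (k + 1) * δ ^ k * (δ' - δ) ≤ δ' ^ (k + 1) := by
    have : 0 ≤ δ ^ (k + 1) := by positivity
    linarith
  calc _ = ((k + 1) * δ ^ k * (δ' - δ)) * ((k : ℝ) + 1) ^ 2 * k.factorial := by ring
    _ ≤ δ' ^ (k + 1) * ((k : ℝ) + 1 + 1) ^ 2 * k.factorial := by
      have : 0 ≤ δ' := h0.trans h.le
      gcongr
      linarith
    _ = _ := by ring

namespace HInf

variable {f g : ℝ → ℂ}

/-- The other way to pay for a derivative: one Sobolev exponent, with no loss of radius. It serves
the term `u_x²` under `Λ⁻² ∂ₓ`. -/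
lemma eNormE_deriv_le (hf : HInf f) (δ s : ℝ) :
    eNormE δ s (_root_.deriv f) ≤ eNormE δ (s + 1) f := by
  refine eNormE_le_iff.2 fun k => le_trans (mul_le_mul_right ?_ _)
    (coeffE_mul_sobolevENorm_le δ (s + 1) f k)
  rw [← iteratedDeriv_succ', iteratedDeriv_succ]
  exact (hf.iteratedDeriv k).sobolevENorm_deriv_le s

lemma eNormE_helmDeriv_le (hf : HInf f) (δ s : ℝ) :
    eNormE δ (s + 1) (GenCH.helmDeriv f) ≤ eNormE δ s f :=
  eNormE_le_iff.2 fun k => le_trans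
    (mul_le_mul_right (hf.sobolevENorm_iteratedDeriv_helmDeriv_le s k) _)
    (coeffE_mul_sobolevENorm_le δ s f k)

lemma enorm_le_eNormE (hf : HInf f) {s : ℝ} (hs : 1 ≤ s) (δ x : ℝ) :
    ‖f x‖ₑ ≤ sobolevConst * eNormE δ s f :=
  (hf.enorm_le hs x).trans (mul_le_mul_right (sobolevENorm_le_eNormE δ s f) _)

end HInf

lemma sobolevENorm_zero (s : ℝ) : sobolevENorm s 0 = 0 := by
  simpa using sobolevENorm_smul_le s 0 0

lemma sobolevENorm_sum_le {ι : Type*} (s : ℝ) (S : Finset ι) (f : ι → ℝ → ℂ) :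
    sobolevENorm s (∑ i ∈ S, f i) ≤ ∑ i ∈ S, sobolevENorm s (f i) := by
  classical
  induction S using Finset.induction_on with
  | empty => simp [sobolevENorm_zero]
  | insert a S ha ih =>
    rw [Finset.sum_insert ha, Finset.sum_insert ha]
    exact (sobolevENorm_add_le s _ _).trans (by gcongr)

/-- By the Leibniz rule, the binomial coefficient turns `1/k!` into `1/(i! j!)` and `δ^k` factors as
`δ^i δ^j`. Only `(k+1)²/((i+1)²(j+1)²)` remains, with sum at most `8`. -/
lemma HInf.eNormE_mul_le {f g : ℝ → ℂ} (hf : HInf f) (hg : HInf g) {δ s : ℝ} (hδ : 0 ≤ δ)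
    (hs : 1 ≤ s) :
    eNormE δ s (f * g) ≤ 8 * algebraConst s * (eNormE δ s f * eNormE δ s g) := by
  refine eNormE_le_iff.2 fun k => ?_
  have hterm : ∀ p ∈ Finset.HasAntidiagonal.antidiagonal k,
      ENNReal.ofReal (coeffE δ k) * sobolevENorm s
        ((k.choose p.1 : ℂ) • (_root_.iteratedDeriv p.1 f * _root_.iteratedDeriv p.2 g)) ≤
      ENNReal.ofReal (((k : ℝ) + 1) ^ 2 * (1 / ((p.1 : ℝ) + 1) ^ 2 * (1 / ((p.2 : ℝ) + 1) ^ 2))) *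
        (algebraConst s * (eNormE δ s f * eNormE δ s g)) := by
    rintro ⟨i, j⟩ hp
    have hij : i + j = k := Finset.HasAntidiagonal.mem_antidiagonal.1 hp
    have hc : coeffE δ k * (k.choose i : ℝ) =
        ((k : ℝ) + 1) ^ 2 * (1 / ((i : ℝ) + 1) ^ 2 * (1 / ((j : ℝ) + 1) ^ 2)) *
          (coeffE δ i * coeffE δ j) := by
      subst hij
      have h1 := Nat.cast_pos (α := ℝ).2 i.factorial_pos
      have h2 := Nat.cast_pos (α := ℝ).2 j.factorial_pos
      have h3 := Nat.cast_pos (α := ℝ).2 (i + j).factorial_pos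
      unfold coeffE
      rw [Nat.cast_add_choose, pow_add]
      push_cast
      field_simp
    have hnorm : ‖(k.choose i : ℂ)‖ₑ = ENNReal.ofReal (k.choose i : ℝ) := by
      rw [← ofReal_norm]; simp
    have hδi : 0 ≤ coeffE δ i := by unfold coeffE; positivity
    have hδj : 0 ≤ coeffE δ j := by unfold coeffE; positivity
    have hδk : 0 ≤ coeffE δ k := by unfold coeffE; positivity
    calc _ ≤ ENNReal.ofReal (coeffE δ k) * (ENNReal.ofReal (k.choose i : ℝ) *
          (algebraConst s * (sobolevENorm s (_root_.iteratedDeriv i f) *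
            sobolevENorm s (_root_.iteratedDeriv j g)))) := by
          rw [← hnorm]
          refine mul_le_mul_right ((sobolevENorm_smul_le s _ _).trans (mul_le_mul_right ?_ _)) _
          exact ((hf.iteratedDeriv i).sobolevENorm_mul_le (hg.iteratedDeriv j) hs).2
      _ = ENNReal.ofReal (((k : ℝ) + 1) ^ 2 * (1 / ((i : ℝ) + 1) ^ 2 * (1 / ((j : ℝ) + 1) ^ 2))) *
          (algebraConst s * ((ENNReal.ofReal (coeffE δ i) *
              sobolevENorm s (_root_.iteratedDeriv i f)) *
            (ENNReal.ofReal (coeffE δ j) * sobolevENorm s (_root_.iteratedDeriv j g)))) := by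
          rw [← mul_assoc, ← ENNReal.ofReal_mul hδk, hc, ENNReal.ofReal_mul (by positivity),
            ENNReal.ofReal_mul hδi]
          ring
      _ ≤ _ := by
          gcongr
          · exact coeffE_mul_sobolevENorm_le δ s f i
          · exact coeffE_mul_sobolevENorm_le δ s g j
  rw [hf.iteratedDeriv_mul hg]
  calc _ ≤ ∑ p ∈ Finset.HasAntidiagonal.antidiagonal k, ENNReal.ofReal (coeffE δ k) *
        sobolevENorm s
        ((k.choose p.1 : ℂ) • (_root_.iteratedDeriv p.1 f * _root_.iteratedDeriv p.2 g)) := by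
        rw [← Finset.mul_sum]
        exact mul_le_mul_right (sobolevENorm_sum_le s _ _) _
    _ ≤ _ := Finset.sum_le_sum hterm
    _ = ENNReal.ofReal (∑ p ∈ Finset.HasAntidiagonal.antidiagonal k,
          ((k : ℝ) + 1) ^ 2 * (1 / ((p.1 : ℝ) + 1) ^ 2 * (1 / ((p.2 : ℝ) + 1) ^ 2))) *
        (algebraConst s * (eNormE δ s f * eNormE δ s g)) := by
        rw [← Finset.sum_mul, ENNReal.ofReal_sum_of_nonneg fun _ _ => by positivity]
    _ ≤ ENNReal.ofReal 8 * (algebraConst s * (eNormE δ s f * eNormE δ s g)) := by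
        refine mul_le_mul_left (ENNReal.ofReal_le_ofReal ?_) _
        rw [← Finset.mul_sum]
        calc _ ≤ ((k : ℝ) + 1) ^ 2 * (8 * (1 / ((k : ℝ) + 1) ^ 2)) := by
              gcongr
              exact sum_antidiagonal_inv_sq_le k
          _ = 8 := by field_simp
    _ = _ := by rw [ENNReal.ofReal_ofNat, mul_assoc]

/-- The Sobolev norm is `⊤` off `L²`, and for `δ > 0` every coefficient is positive, so a finite
supremum puts each derivative in `L²`. -/
lemma hInf_of_eNormE_lt_top {δ s : ℝ} (hδ : 0 < δ) {f : ℝ → ℂ} (hf : ContDiff ℝ ∞ f)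
    (h : eNormE δ s f < ⊤) : HInf f where
  contDiff := hf
  memLp_iteratedDeriv k := by
    have h1 := (coeffE_mul_sobolevENorm_le δ s f k).trans_lt h
    by_contra hk
    have : sobolevENorm s (iteratedDeriv k f) = ⊤ := by simp [sobolevENorm, hk]
    rw [this, ENNReal.mul_top (by simpa using coeffE_pos hδ k)] at h1
    exact lt_irrefl _ h1

lemma EC.hInf {δ s : ℝ} (hδ : 0 < δ) (f : EC δ s) : HInf f :=
  hInf_of_eNormE_lt_top hδ f.2.1 f.2.2

/-! ### Series in the Sobolev norms, and completeness of `E_{δ,s}` -/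

/-- The sum taken in `L²` coincides almost everywhere with the pointwise sum, so the triangle
inequality for series applies to the latter. -/
lemma memLp_tsum_and_eLpNorm_le {X : Type*} [MeasurableSpace X] {μ : Measure X} {f : ℕ → X → ℂ}
    (hf : ∀ n, AEStronglyMeasurable (f n) μ) (h : ∑' n, eLpNorm (f n) 2 μ ≠ ⊤) :
    MemLp (fun x => ∑' n, f n x) 2 μ ∧
      eLpNorm (fun x => ∑' n, f n x) 2 μ ≤ ∑' n, eLpNorm (f n) 2 μ := by
  have hm : ∀ n, MemLp (f n) 2 μ := fun n => ⟨hf n, (ENNReal.le_tsum n).trans_lt h.lt_top⟩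
  have he : ∀ n, ‖(hm n).toLp (f n)‖ₑ = eLpNorm (f n) 2 μ := fun n => by
    rw [Lp.enorm_def, eLpNorm_congr_ae (hm n).coeFn_toLp]
  have hsum : ∑' n, ‖(hm n).toLp (f n)‖ₑ ≠ ⊤ := by simpa only [he] using h
  have hae : (∑' n, (hm n).toLp (f n) : Lp ℂ 2 μ) =ᵐ[μ] fun x => ∑' n, f n x := by
    have hall : ∀ᵐ x ∂μ, ∀ n, (hm n).toLp (f n) x = f n x :=
      ae_all_iff.2 fun n => (hm n).coeFn_toLp
    filter_upwards [Lp.coeFn_tsum hsum, hall] with x hx hx'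
    rw [hx]
    simp only [hx']
  refine ⟨(memLp_congr_ae hae).1 (Lp.memLp _), ?_⟩
  rw [← eLpNorm_congr_ae hae, ← Lp.enorm_def]
  simpa only [he] using enorm_tsum_le_tsum_enorm (f := fun n => (hm n).toLp (f n))

/-- The transforms are summed in the weighted `L²` space. They are also summable in `L¹`, so
summation and the inverse Fourier integral can be interchanged: the pointwise sum has the summed
transform. -/
lemma sobolevENorm_tsum_le {s : ℝ} (hs : 1 ≤ s) {g : ℕ → ℝ → ℂ} (hg : ∀ n, HInf (g n))
    (h : ∑' n, sobolevENorm s (g n) ≠ ⊤) :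
    sobolevENorm s (fun x => ∑' n, g n x) ≤ ∑' n, sobolevENorm s (g n) := by
  set φ : ℕ → ℝ → ℂ := fun n => fourierL2 (g n) with hφ
  have hφm : ∀ n, AEStronglyMeasurable (φ n) volume := fun n => aestronglyMeasurable_fourierL2 _
  have hw : ∀ n, sobolevENorm s (g n) = weightedENorm s (φ n) := fun n =>
    sobolevENorm_of_memLp (hg n).memLp s
  simp only [hw] at h ⊢
  have hW := memLp_tsum_and_eLpNorm_le
    (fun n => (measurable_symb_rpow (s / 2)).aestronglyMeasurable.mul (hφm n)) h
  have h2 := (memLp_tsum_and_eLpNorm_le hφm (ne_top_of_le_ne_top h (ENNReal.tsum_le_tsum fun n =>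
    eLpNorm_two_le_weightedENorm (zero_le_one.trans hs) (φ n)))).1
  have hWΦ : weightedENorm s (fun ξ => ∑' n, φ n ξ) ≤ ∑' n, weightedENorm s (φ n) := by
    refine le_trans (le_of_eq ?_) hW.2
    simp only [weightedENorm, ← tsum_mul_left]
    rfl
  have h1 := integrable_of_weightedENorm_lt_top hs h2.1 (hWΦ.trans_lt h.lt_top)
  have hL1 : ∑' n, ∫⁻ ξ, ‖φ n ξ‖ₑ ≠ ⊤ := by
    refine ne_top_of_le_ne_top (b := sobolevConst * ∑' n, weightedENorm s (φ n))
      (ENNReal.mul_lt_top sobolevConst_lt_top h.lt_top).ne ?_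
    rw [← ENNReal.tsum_mul_left]
    refine ENNReal.tsum_le_tsum fun n => ?_
    rw [← eLpNorm_one_eq_lintegral_enorm]
    exact eLpNorm_one_le_weightedENorm hs (hφm n)
  have hG : (fun x => ∑' n, g n x) = 𝓕⁻ (fun ξ => ∑' n, φ n ξ) := by
    ext x
    have hx : ∀ n, g n x = ∫ ξ, Real.fourierChar (inner ℝ ξ x) • φ n ξ := fun n => by
      conv_lhs => rw [(hg n).eq_fourierInv]
      exact Real.fourierInv_eq _ _
    rw [Real.fourierInv_eq]
    simp only [hx]
    rw [← integral_tsum]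
    · congr 1
      ext ξ
      simp only [Circle.smul_def, smul_eq_mul, tsum_mul_left]
    · intro n
      exact ((Real.continuous_fourierChar.comp (by fun_prop)).aestronglyMeasurable).smul (hφm n)
    · refine ne_top_of_le_ne_top hL1 (ENNReal.tsum_le_tsum fun n => lintegral_mono fun ξ => ?_)
      rw [← ofReal_norm, Circle.norm_smul, ofReal_norm]
  obtain ⟨h3, h4⟩ := memLp_fourierInv_and_fourierL2 h1 h2
  rw [hG, sobolevENorm_of_memLp h3, weightedENorm_congr_ae h4]
  exact hWΦ

section TsumE

variable {δ s : ℝ} {f : ℕ → ℝ → ℂ}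

/-- Weierstrass bounds from the Sobolev embedding; they justify termwise differentiation to every
order. -/
lemma summable_bound_iteratedDeriv (hδ : 0 < δ) (hs : 1 ≤ s) (hf : ∀ n, HInf (f n))
    (h : ∑' n, eNormE δ s (f n) ≠ ⊤) (k : ℕ) :
    ∃ v : ℕ → ℝ, Summable v ∧ ∀ n x, ‖iteratedDeriv k (f n) x‖ ≤ v n := by
  set c := ENNReal.ofReal (coeffE δ k) with hc
  have hc0 : c ≠ 0 := by simpa [hc] using coeffE_pos hδ k
  have hb : ∀ n x, ‖iteratedDeriv k (f n) x‖ₑ ≤ sobolevConst * (c⁻¹ * eNormE δ s (f n)) := by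
    intro n x
    refine (((hf n).iteratedDeriv k).enorm_le hs x).trans (mul_le_mul_right ?_ _)
    calc _ = c⁻¹ * (c * sobolevENorm s (iteratedDeriv k (f n))) := by
          rw [← mul_assoc, ENNReal.inv_mul_cancel hc0 ENNReal.ofReal_ne_top, one_mul]
      _ ≤ _ := mul_le_mul_right (coeffE_mul_sobolevENorm_le δ s (f n) k) _
  have hfin : ∑' n, sobolevConst * (c⁻¹ * eNormE δ s (f n)) ≠ ⊤ := by
    rw [ENNReal.tsum_mul_left, ENNReal.tsum_mul_left]
    exact ENNReal.mul_ne_top sobolevConst_lt_top.ne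
      (ENNReal.mul_ne_top (ENNReal.inv_ne_top.2 hc0) h)
  refine ⟨fun n => (sobolevConst * (c⁻¹ * eNormE δ s (f n))).toReal,
    ENNReal.summable_toReal hfin, fun n x => ?_⟩
  rw [← toReal_enorm]
  exact ENNReal.toReal_mono (ENNReal.ne_top_of_tsum_ne_top hfin n) (hb n x)

lemma contDiff_tsum_of_eNormE (hδ : 0 < δ) (hs : 1 ≤ s) (hf : ∀ n, HInf (f n))
    (h : ∑' n, eNormE δ s (f n) ≠ ⊤) : ContDiff ℝ ∞ fun x => ∑' n, f n x := by
  choose v hv hb using summable_bound_iteratedDeriv hδ hs hf h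
  refine contDiff_tsum (N := ⊤) (v := v) (fun n => (hf n).contDiff) (fun k _ => hv k)
    fun k n x _ => ?_
  rw [norm_iteratedFDeriv_eq_norm_iteratedDeriv]
  exact hb k n x

lemma iteratedDeriv_tsum_of_eNormE (hδ : 0 < δ) (hs : 1 ≤ s) (hf : ∀ n, HInf (f n))
    (h : ∑' n, eNormE δ s (f n) ≠ ⊤) (k : ℕ) :
    iteratedDeriv k (fun x => ∑' n, f n x) = fun x => ∑' n, iteratedDeriv k (f n) x := by
  choose v hv hb using summable_bound_iteratedDeriv hδ hs hf h
  induction k with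
  | zero => simp
  | succ k ih =>
    rw [iteratedDeriv_succ, ih]
    simp only [iteratedDeriv_succ]
    refine deriv_tsum (hv (k + 1)) (fun n => ((hf n).iteratedDeriv k).differentiable)
      (fun n x => ?_) (y₀ := 0) (Summable.of_norm_bounded (hv k) fun n => hb k n 0)
    rw [← iteratedDeriv_succ]
    exact hb (k + 1) n x

lemma eNormE_tsum_le (hδ : 0 < δ) (hs : 1 ≤ s) (hf : ∀ n, HInf (f n))
    (h : ∑' n, eNormE δ s (f n) ≠ ⊤) :
    eNormE δ s (fun x => ∑' n, f n x) ≤ ∑' n, eNormE δ s (f n) := by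
  refine eNormE_le_iff.2 fun k => ?_
  set c := ENNReal.ofReal (coeffE δ k) with hc
  have hc0 : c ≠ 0 := by simpa [hc] using coeffE_pos hδ k
  have hle : c * ∑' n, sobolevENorm s (iteratedDeriv k (f n)) ≤ ∑' n, eNormE δ s (f n) := by
    rw [← ENNReal.tsum_mul_left]
    exact ENNReal.tsum_le_tsum fun n => coeffE_mul_sobolevENorm_le δ s (f n) k
  rw [iteratedDeriv_tsum_of_eNormE hδ hs hf h]
  refine le_trans (mul_le_mul_right
    (sobolevENorm_tsum_le hs (fun n => (hf n).iteratedDeriv k) fun htop => ?_) _) hle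
  rw [htop, ENNReal.mul_top hc0] at hle
  exact h (top_le_iff.1 hle)

end TsumE

lemma EC.enorm_eq {δ s : ℝ} (f : EC δ s) : ‖f‖ₑ = eNormE δ s f := by
  rw [← ofReal_norm, EC.norm_def, ENNReal.ofReal_toReal f.2.2.ne]

lemma EC.coe_sub {δ s : ℝ} (f g : EC δ s) : ((f - g : EC δ s) : ℝ → ℂ) = ⇑f - ⇑g := rfl

lemma EC.coe_sum {δ s : ℝ} {ι : Type*} (S : Finset ι) (f : ι → EC δ s) :
    ((∑ i ∈ S, f i : EC δ s) : ℝ → ℂ) = ∑ i ∈ S, (f i : ℝ → ℂ) :=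
  map_sum (submoduleE δ s).subtype f S

/-- Absolutely convergent series converge to their pointwise sums: a remainder is itself such a sum,
and countable subadditivity bounds its norm by the tail of the series of norms. -/
lemma EC.completeSpace {δ s : ℝ} (hδ : 0 < δ) (hs : 1 ≤ s) : CompleteSpace (EC δ s) := by
  refine NormedAddCommGroup.completeSpace_of_summable_imp_tendsto fun u hu => ?_
  have hH : ∀ n, HInf (u n) := fun n => EC.hInf hδ (u n)
  have hsum : ∑' n, eNormE δ s (u n) ≠ ⊤ := by
    simp only [← EC.enorm_eq]
    exact tsum_enorm_ne_top_iff_summable_norm.2 hu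
  let a : EC δ s := ⟨fun x => ∑' n, u n x, contDiff_tsum_of_eNormE hδ hs hH hsum,
    (eNormE_tsum_le hδ hs hH hsum).trans_lt hsum.lt_top⟩
  refine ⟨a, tendsto_iff_edist_tendsto_0.2 ?_⟩
  have htail := ENNReal.tendsto_sum_nat_add (fun n => eNormE δ s (u n)) hsum
  refine tendsto_of_tendsto_of_tendsto_of_le_of_le tendsto_const_nhds htail
    (fun _ => zero_le) fun N => ?_
  rw [edist_comm, edist_eq_enorm_sub, EC.enorm_eq]
  have hsumN : ∑' n, eNormE δ s (u (n + N)) ≠ ⊤ := ne_top_of_le_ne_top hsum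
    (ENNReal.tsum_comp_le_tsum_of_injective (add_left_injective N) fun n => eNormE δ s (u n))
  obtain ⟨v, hv, hb⟩ := summable_bound_iteratedDeriv hδ hs hH hsum 0
  have hcoe : ((a - ∑ i ∈ Finset.range N, u i : EC δ s) : ℝ → ℂ) =
      fun x => ∑' n, u (n + N) x := by
    ext x
    rw [EC.coe_sub, EC.coe_sum, Pi.sub_apply, Finset.sum_apply, sub_eq_iff_eq_add']
    exact (Summable.sum_add_tsum_nat_add N (Summable.of_norm_bounded hv fun n => by
      simpa using hb n x)).symm
  rw [hcoe]
  exact eNormE_tsum_le hδ hs (fun n => hH (n + N)) hsumN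

/-! ### Quadratic differential equations, tested against linear functionals -/

section Quadratic

variable {X ι : Type*} [NormedAddCommGroup X] [NormedSpace ℂ X]

/-- `U` is holomorphic on the disk of radius `r` and solves `e U' = L U + B (U, U)` for every
triple of a functional `e`, a linear form `L` and a bilinear form `B` in the family. -/
structure IsQuadraticSolution (e L : ι → X →L[ℂ] ℂ) (B : ι → X →L[ℂ] X →L[ℂ] ℂ) (r : ℝ)
    (U : ℂ → X) : Prop where
  holomorphic : DifferentiableOn ℂ U (Metric.ball 0 r)
  eq : ∀ t ∈ Metric.ball (0 : ℂ) r, ∀ j, e j (deriv U t) = L j (U t) + B j (U t) (U t)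

variable [CompleteSpace X] {e L : ι → X →L[ℂ] ℂ} {B : ι → X →L[ℂ] X →L[ℂ] ℂ} {r : ℝ}

/-- By the identity theorem it suffices to work near `0`. If the difference does not vanish there,
the lowest-order term of its equation is contradictory, because the right-hand side has the full
order of vanishing while the derivative has one less. Only the scalar equations are used, so no
Lipschitz bound on the vector field is needed. -/
theorem IsQuadraticSolution.eqOn (he : ∀ x : X, (∀ j, e j x = 0) → x = 0) {U W : ℂ → X}
    (hU : IsQuadraticSolution e L B r U) (hW : IsQuadraticSolution e L B r W)
    (h0 : W 0 = U 0) : Set.EqOn W U (Metric.ball 0 r) := by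
  rcases le_or_gt r 0 with hr | hr
  · rw [Metric.ball_eq_empty.2 hr]
    exact Set.eqOn_empty _ _
  have hball : Metric.ball (0 : ℂ) r ∈ 𝓝 0 := Metric.ball_mem_nhds 0 hr
  have hUa := hU.holomorphic.analyticOnNhd Metric.isOpen_ball
  have hWa := hW.holomorphic.analyticOnNhd Metric.isOpen_ball
  have h0mem : (0 : ℂ) ∈ Metric.ball (0 : ℂ) r := Metric.mem_ball_self hr
  refine hWa.eqOn_of_preconnected_of_eventuallyEq hUa
    (convex_ball (0 : ℂ) r).isPreconnected h0mem ?_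
  suffices h : ∀ᶠ t in 𝓝 (0 : ℂ), (W - U) t = 0 by
    filter_upwards [h] with t ht
    exact sub_eq_zero.1 ht
  by_contra hne
  -- Here `n` is the exact order of vanishing of `W - U` at `0`.
  obtain ⟨n, g, hg, hg0, hD⟩ := ((hWa 0 h0mem).sub
    (hUa 0 h0mem)).exists_eventuallyEq_pow_smul_nonzero_iff.2 hne
  simp only [sub_zero] at hD
  -- Equal initial values exclude order zero.
  obtain ⟨m, rfl⟩ : ∃ m, n = m + 1 := by
    refine Nat.exists_eq_succ_of_ne_zero ?_
    rintro rfl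
    have := hD.self_of_nhds
    simp only [Pi.sub_apply, h0, sub_self, pow_zero, one_smul] at this
    exact hg0 this.symm
  have hgd : ∀ᶠ t in 𝓝 (0 : ℂ), DifferentiableAt ℂ g t :=
    hg.eventually_analyticAt.mono fun t ht => ht.differentiableAt
  refine hg0 (he _ fun j => ?_)
  -- The difference of the two equations divided by `t^m`, using `B(W,W) - B(U,U) = B(D,W) + B(U,D)`
  -- with `D = t^(m+1) g`. As `t → 0` the right-hand side vanishes and the left tends to `(m+1) e j
  -- (g 0)`.
  have key : ∀ᶠ t in 𝓝[≠] (0 : ℂ), ((m : ℂ) + 1) * e j (g t) =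
      t * (L j (g t) + B j (g t) (W t) + B j (U t) (g t) - e j (deriv g t)) := by
    filter_upwards [self_mem_nhdsWithin, mem_nhdsWithin_of_mem_nhds hball,
      hgd.filter_mono nhdsWithin_le_nhds, hD.eventually_nhds.filter_mono nhdsWithin_le_nhds]
      with t ht0 htb htg htD
    have hWd := (hW.holomorphic.differentiableAt (Metric.isOpen_ball.mem_nhds htb))
    have hUd := (hU.holomorphic.differentiableAt (Metric.isOpen_ball.mem_nhds htb))
    have hd1 : deriv (W - U) t = deriv W t - deriv U t := deriv_sub hWd hUd
    have hd2 : deriv (W - U) t =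
        t ^ (m + 1) • deriv g t + (((m + 1 : ℕ) : ℂ) * t ^ m) • g t := by
      have h := ((hasDerivAt_pow (m + 1) t).smul htg.hasDerivAt).deriv
      rw [EventuallyEq.deriv_eq (f := fun t => t ^ (m + 1) • g t) htD]
      exact h
    have hDt : W t - U t = t ^ (m + 1) • g t := htD.self_of_nhds
    have hWt : W t = U t + t ^ (m + 1) • g t := by rw [← hDt]; abel
    have e1 := hW.eq t htb j
    have e2 := hU.eq t htb j
    have e3 : e j (deriv W t) - e j (deriv U t) = t ^ (m + 1) * e j (deriv g t) +
        (((m : ℂ) + 1) * t ^ m) * e j (g t) := by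
      rw [← map_sub, ← hd1, hd2]
      simp
    have e4 : L j (W t) = L j (U t) + t ^ (m + 1) * L j (g t) := by rw [hWt]; simp
    have e5 : B j (W t) (W t) = B j (U t) (U t) + t ^ (m + 1) * B j (U t) (g t) +
        t ^ (m + 1) * B j (g t) (W t) := by
      have : B j (W t) (W t) = B j (U t) (W t) + t ^ (m + 1) * B j (g t) (W t) := by
        conv_lhs => rw [show B j (W t) = B j (U t + t ^ (m + 1) • g t) from congrArg _ hWt]
        simp
      rw [this]
      conv_lhs => rw [show B j (U t) (W t) = B j (U t) (U t + t ^ (m + 1) • g t) from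
        congrArg _ hWt]
      simp
    have htm : t ^ m ≠ 0 := pow_ne_zero _ ht0
    apply mul_left_cancel₀ htm
    rw [e1, e2, e4, e5] at e3
    linear_combination -e3
  have hgc := hg.continuousAt
  have hg'c := hg.deriv.continuousAt
  have hWc := (hWa 0 h0mem).continuousAt
  have hUc := (hUa 0 h0mem).continuousAt
  have l1 : Tendsto (fun t => ((m : ℂ) + 1) * e j (g t)) (𝓝[≠] 0)
      (𝓝 (((m : ℂ) + 1) * e j (g 0))) :=
    (ContinuousAt.mul continuousAt_const ((e j).continuous.continuousAt.comp hgc)).tendsto.mono_left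
      nhdsWithin_le_nhds
  have l2 : Tendsto (fun t => t * (L j (g t) + B j (g t) (W t) + B j (U t) (g t) -
      e j (deriv g t))) (𝓝[≠] 0) (𝓝 (0 * (L j (g 0) + B j (g 0) (W 0) + B j (U 0) (g 0) -
      e j (deriv g 0)))) := by
    refine Tendsto.mono_left ?_ nhdsWithin_le_nhds
    refine tendsto_id.mul (((((L j).continuous.tendsto _).comp hgc).add ?_).add ?_ |>.sub
      (((e j).continuous.tendsto _).comp hg'c))
    · exact (((B j).continuous.continuousAt.comp hgc).clm_apply hWc).tendsto
    · exact (((B j).continuous.continuousAt.comp hUc).clm_apply hgc).tendsto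
  have := tendsto_nhds_unique (l1.congr' key) l2
  rw [zero_mul] at this
  exact (mul_eq_zero.1 this).resolve_left (by exact_mod_cast Nat.succ_ne_zero m)

/-- The Cauchy product of two absolutely convergent series, for a bounded bilinear form. -/
theorem hasSum_bilin_antidiagonal (b : X →L[ℂ] X →L[ℂ] ℂ) {x y : ℕ → X}
    (hx : Summable fun n => ‖x n‖) (hy : Summable fun n => ‖y n‖) :
    HasSum (fun n => ∑ p ∈ Finset.HasAntidiagonal.antidiagonal n, b (x p.1) (y p.2))
      (b (∑' n, x n) (∑' n, y n)) := by
  have hs : Summable fun p : ℕ × ℕ => b (x p.1) (y p.2) := by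
    refine Summable.of_norm_bounded (g := fun p : ℕ × ℕ => ‖b‖ * (‖x p.1‖ * ‖y p.2‖))
      ((hx.mul_of_nonneg hy (fun _ => norm_nonneg _) fun _ => norm_nonneg _).mul_left _) fun p => ?_
    rw [← mul_assoc]
    exact b.le_opNorm₂ _ _
  have h1 : HasSum (fun p : ℕ × ℕ => b (x p.1) (y p.2)) (b (∑' n, x n) (∑' n, y n)) := by
    have hfib := hs.hasSum.prod_fiberwise (g := fun i => b (x i) (∑' n, y n))
      fun i => (b (x i)).hasSum hy.of_norm.hasSum
    have hsum : HasSum (fun i => b (x i) (∑' n, y n)) (b (∑' n, x n) (∑' n, y n)) :=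
      (b.flip (∑' n, y n)).hasSum hx.of_norm.hasSum
    rw [← hfib.unique hsum]
    exact hs.hasSum
  rw [← Finset.HasAntidiagonal.sigmaAntidiagonalEquivProd.hasSum_iff] at h1
  refine h1.sigma fun n => ?_
  have := Finset.hasSum (Finset.HasAntidiagonal.antidiagonal n) (fun p => b (x p.1) (y p.2))
  simpa [Function.comp_def] using this

/-- The series may be differentiated termwise inside the disk, and the recursion says that both
sides of the equation have the same Taylor coefficients. -/
theorem isQuadraticSolution_tsum {a : ℕ → X}
    (hsum : ∀ ρ : ℝ, 0 ≤ ρ → ρ < r → Summable fun n => ‖a n‖ * ρ ^ n)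
    (hrec : ∀ (n : ℕ) j, ((n : ℂ) + 1) * e j (a (n + 1)) =
      L j (a n) + ∑ p ∈ Finset.HasAntidiagonal.antidiagonal n, B j (a p.1) (a p.2)) :
    IsQuadraticSolution e L B r fun t => ∑' n, t ^ n • a n := by
  have hterm : ∀ n : ℕ, Differentiable ℂ fun t : ℂ => t ^ n • a n := fun n =>
    (differentiable_id.pow n).smul_const (a n)
  have hbound : ∀ ρ : ℝ, ∀ (n : ℕ) (w : ℂ), w ∈ Metric.ball (0 : ℂ) ρ →
      ‖w ^ n • a n‖ ≤ ‖a n‖ * ρ ^ n := fun ρ n w hw => by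
    rw [norm_smul, norm_pow, mul_comm]
    have := (mem_ball_zero_iff.1 hw).le
    gcongr
  have hρ : ∀ t ∈ Metric.ball (0 : ℂ) r, ∃ ρ, 0 ≤ ρ ∧ ρ < r ∧ t ∈ Metric.ball (0 : ℂ) ρ := by
    intro t ht
    obtain ⟨ρ, h1, h2⟩ := exists_between (mem_ball_zero_iff.1 ht)
    exact ⟨ρ, (norm_nonneg t).trans h1.le, h2, mem_ball_zero_iff.2 h1⟩
  refine ⟨fun t ht => ?_, fun t ht j => ?_⟩
  · obtain ⟨ρ, h1, h2, h3⟩ := hρ t ht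
    exact ((Complex.differentiableOn_tsum_of_summable_norm (hsum ρ h1 h2)
      (fun n => (hterm n).differentiableOn) Metric.isOpen_ball (hbound ρ)).differentiableAt
      (Metric.isOpen_ball.mem_nhds h3)).differentiableWithinAt
  · obtain ⟨ρ, h1, h2, h3⟩ := hρ t ht
    have hx : Summable fun n => ‖t ^ n • a n‖ :=
      Summable.of_nonneg_of_le (fun _ => norm_nonneg _) (fun n => hbound ρ n t h3) (hsum ρ h1 h2)
    have hd := Complex.hasSum_deriv_of_summable_norm (hsum ρ h1 h2)
      (fun n => (hterm n).differentiableOn) Metric.isOpen_ball (hbound ρ) h3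
    have hd' : ∀ n : ℕ, deriv (fun t : ℂ => t ^ n • a n) t = ((n : ℂ) * t ^ (n - 1)) • a n :=
      fun n => ((hasDerivAt_pow n t).smul_const (a n)).deriv
    simp only [hd'] at hd
    have hL := (e j).hasSum hd
    -- The term `n = 0` of the differentiated series is zero because of its factor `n`; dropping it
    -- aligns the indices with the Cauchy product.
    rw [← hasSum_nat_add_iff' 1] at hL
    have hR := ((L j).hasSum hx.of_norm.hasSum).add (hasSum_bilin_antidiagonal (B j) hx hx)
    have hterms : ∀ n : ℕ, L j (t ^ n • a n) + ∑ p ∈ Finset.HasAntidiagonal.antidiagonal n,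
        B j (t ^ p.1 • a p.1) (t ^ p.2 • a p.2) =
        e j ((((n + 1 : ℕ) : ℂ) * t ^ (n + 1 - 1)) • a (n + 1)) := by
      intro n
      have hp : ∀ p ∈ Finset.HasAntidiagonal.antidiagonal n,
          B j (t ^ p.1 • a p.1) (t ^ p.2 • a p.2) = t ^ n * B j (a p.1) (a p.2) := by
        intro p hp
        rw [← Finset.HasAntidiagonal.mem_antidiagonal.1 hp, pow_add]
        simp only [map_smul, smul_apply, smul_eq_mul]
        ring
      rw [Finset.sum_congr rfl hp, ← Finset.mul_sum, map_smul, map_smul, smul_eq_mul, smul_eq_mul,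
        ← mul_add, ← hrec n j]
      push_cast
      ring
    simp only [hterms] at hR
    have := hL.unique hR
    simpa using this

end Quadratic

/-! ### The linear and the bilinear part of the system -/

lemma eNormE_neg_le (δ s : ℝ) (f : ℝ → ℂ) : eNormE δ s (-f) ≤ eNormE δ s f := by
  have h := eNormE_smul_le δ s (-1) f
  rwa [neg_one_smul, enorm_neg, enorm_one, one_mul] at h

/-- The linear part of the system: `-(Λ⁻² ∂ₓ (-α u + v), u_x)`. -/
noncomputable def opL (α : ℝ) (p : (ℝ → ℂ) × (ℝ → ℂ)) : (ℝ → ℂ) × (ℝ → ℂ) :=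
  (-helmDeriv (-(α : ℂ) • p.1 + p.2), -deriv p.1)

/-- The argument of `Λ⁻² ∂ₓ` in the bilinear part of the system. -/
noncomputable def fluxB (β : ℝ) (p q : (ℝ → ℂ) × (ℝ → ℂ)) : ℝ → ℂ :=
  ((3 - (β : ℂ)) / 2) • (p.1 * q.1) + ((β : ℂ) / 2) • (deriv p.1 * deriv q.1) +
    (1 / 2 : ℂ) • (p.2 * q.2)

/-- The bilinear part of the system. -/
noncomputable def opB (β : ℝ) (p q : (ℝ → ℂ) × (ℝ → ℂ)) : (ℝ → ℂ) × (ℝ → ℂ) :=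
  (-((β : ℂ) • (p.1 * deriv q.1) + helmDeriv (fluxB β p q)),
    -(deriv p.1 * q.2 + p.1 * deriv q.2))

/-- Both components belong to `H^∞`. -/
structure HInfPair (p : (ℝ → ℂ) × (ℝ → ℂ)) : Prop where
  fst : HInf p.1
  snd : HInf p.2

/-- The norm of a pair of functions. -/
noncomputable def pairENorm (δ s : ℝ) (p : (ℝ → ℂ) × (ℝ → ℂ)) : ℝ≥0∞ :=
  eNormE δ s p.1 + eNormE δ s p.2

lemma pairENorm_mono {δ δ' s : ℝ} (h0 : 0 ≤ δ) (h : δ ≤ δ') (p : (ℝ → ℂ) × (ℝ → ℂ)) :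
    pairENorm δ s p ≤ pairENorm δ' s p :=
  add_le_add (eNormE_mono h0 h _) (eNormE_mono h0 h _)

lemma pairENorm_smul_le (δ s : ℝ) (c : ℂ) (p : (ℝ → ℂ) × (ℝ → ℂ)) :
    pairENorm δ s (c • p) ≤ ‖c‖ₑ * pairENorm δ s p := by
  rw [pairENorm, pairENorm, mul_add]
  exact add_le_add (eNormE_smul_le _ _ _ _) (eNormE_smul_le _ _ _ _)

lemma fst_le_pairENorm (δ s : ℝ) (p : (ℝ → ℂ) × (ℝ → ℂ)) : eNormE δ s p.1 ≤ pairENorm δ s p :=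
  le_self_add

lemma snd_le_pairENorm (δ s : ℝ) (p : (ℝ → ℂ) × (ℝ → ℂ)) : eNormE δ s p.2 ≤ pairENorm δ s p :=
  le_add_self

namespace HInfPair

variable {p q p' q' : (ℝ → ℂ) × (ℝ → ℂ)}

lemma add (hp : HInfPair p) (hq : HInfPair q) : HInfPair (p + q) :=
  ⟨hp.fst.add hq.fst, hp.snd.add hq.snd⟩

lemma smul (c : ℂ) (hp : HInfPair p) : HInfPair (c • p) := ⟨hp.fst.smul c, hp.snd.smul c⟩

lemma opL (α : ℝ) (hp : HInfPair p) : HInfPair (opL α p) :=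
  ⟨((hp.fst.smul _).add hp.snd).helmDeriv.neg, hp.fst.deriv.neg⟩

lemma fluxB (β : ℝ) (hp : HInfPair p) (hq : HInfPair q) : HInf (fluxB β p q) :=
  (((hp.fst.mul hq.fst).smul _).add ((hp.fst.deriv.mul hq.fst.deriv).smul _)).add
    ((hp.snd.mul hq.snd).smul _)

lemma opB (β : ℝ) (hp : HInfPair p) (hq : HInfPair q) : HInfPair (opB β p q) :=
  ⟨(((hp.fst.mul hq.fst.deriv).smul _).add (hp.fluxB β hq).helmDeriv).neg,
    ((hp.fst.deriv.mul hq.snd).add (hp.fst.mul hq.snd.deriv)).neg⟩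

lemma pairENorm_add_le (hp : HInfPair p) (hq : HInfPair q) (δ s : ℝ) :
    pairENorm δ s (p + q) ≤ pairENorm δ s p + pairENorm δ s q := by
  refine (add_le_add (eNormE_add_le δ s hp.fst.contDiff hq.fst.contDiff)
    (eNormE_add_le δ s hp.snd.contDiff hq.snd.contDiff)).trans (le_of_eq ?_)
  simp only [pairENorm]
  ring

lemma pairENorm_sum_le {ι : Type*} (S : Finset ι) {f : ι → (ℝ → ℂ) × (ℝ → ℂ)}
    (hf : ∀ i ∈ S, HInfPair (f i)) (δ s : ℝ) :
    HInfPair (∑ i ∈ S, f i) ∧ pairENorm δ s (∑ i ∈ S, f i) ≤ ∑ i ∈ S, pairENorm δ s (f i) := by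
  classical
  induction S using Finset.induction_on with
  | empty =>
    have h0 : HInf 0 := by
      refine ⟨contDiff_const, fun k => ?_⟩
      have : _root_.iteratedDeriv k (0 : ℝ → ℂ) = 0 := by
        ext x
        simp
      rw [this]
      exact MemLp.zero
    exact ⟨⟨h0, h0⟩, by simp [pairENorm, eNormE_zero]⟩
  | insert a S ha ih =>
    obtain ⟨h1, h2⟩ := ih fun i hi => hf i (Finset.mem_insert_of_mem hi)
    have h3 := hf a (Finset.mem_insert_self a S)
    rw [Finset.sum_insert ha, Finset.sum_insert ha]
    exact ⟨h3.add h1, (h3.pairENorm_add_le h1 δ s).trans (by gcongr)⟩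

/-- Only `u_x` uses up radius. The nonlocal term is bounded at fixed radius and is absorbed because
`1 ≤ 1/(δ' - δ)`. -/
lemma pairENorm_opL_le (hp : HInfPair p) (α : ℝ) {s δ δ' : ℝ} (h0 : 0 ≤ δ)
    (h : δ < δ') (h1 : δ' - δ ≤ 1) :
    pairENorm δ (s + 1) (GenCH.opL α p) ≤
      (‖(α : ℂ)‖ₑ + 2) * (ENNReal.ofReal (1 / (δ' - δ)) * pairENorm δ' (s + 1) p) := by
  have hd : 0 < δ' - δ := sub_pos.2 h
  set K := ENNReal.ofReal (1 / (δ' - δ)) with hK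
  have hK1 : 1 ≤ K := by
    rw [hK, ← ENNReal.ofReal_one]
    exact ENNReal.ofReal_le_ofReal ((one_le_div hd).2 h1)
  set N := pairENorm δ' (s + 1) p
  have hN : N ≤ K * N := le_mul_of_one_le_left zero_le hK1
  have hu : eNormE δ s p.1 ≤ K * N := ((eNormE_mono_exponent (by linarith) _).trans
    ((eNormE_mono h0 h.le _).trans (fst_le_pairENorm _ _ _))).trans hN
  have hv : eNormE δ s p.2 ≤ K * N := ((eNormE_mono_exponent (by linarith) _).trans
    ((eNormE_mono h0 h.le _).trans (snd_le_pairENorm _ _ _))).trans hN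
  have e1 : eNormE δ (s + 1) (GenCH.opL α p).1 ≤ ‖(α : ℂ)‖ₑ * (K * N) + K * N := by
    refine (eNormE_neg_le _ _ _).trans ((((hp.fst.smul _).add hp.snd).eNormE_helmDeriv_le δ s).trans
      ((eNormE_add_le δ s (hp.fst.smul _).contDiff hp.snd.contDiff).trans (add_le_add ?_ hv)))
    refine (eNormE_smul_le _ _ _ _).trans ?_
    rw [enorm_neg]
    exact mul_le_mul_right hu _
  have e2 : eNormE δ (s + 1) (GenCH.opL α p).2 ≤ K * N :=
    (eNormE_neg_le _ _ _).trans ((eNormE_deriv_le h0 h _ _).trans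
      (mul_le_mul_right (fst_le_pairENorm _ _ _) _))
  calc _ ≤ (‖(α : ℂ)‖ₑ * (K * N) + K * N) + K * N := add_le_add e1 e2
    _ = _ := by ring

/-- The constant in the estimate of `opB`. -/
noncomputable def constB (β s : ℝ) : ℝ≥0∞ :=
  (‖(β : ℂ)‖ₑ + 2) * (8 * algebraConst (s + 1)) +
    (‖(3 - (β : ℂ)) / 2‖ₑ + ‖(β : ℂ) / 2‖ₑ + ‖(1 / 2 : ℂ)‖ₑ) * (8 * algebraConst s)

lemma constB_lt_top (β s : ℝ) : constB β s < ⊤ := by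
  have h := fun s => (algebraConst_lt_top s).ne
  have h' : constB β s ≠ ⊤ := by
    unfold constB
    finiteness [h s, h (s + 1)]
  exact h'.lt_top

/-- A single factor `1/(δ' - δ)` suffices. Each local term differentiates only one of its two
factors, and in the flux the two derivatives are paid for by the Sobolev exponent that `Λ⁻² ∂ₓ`
gives back. -/
lemma pairENorm_opB_le (hp : HInfPair p) (hq : HInfPair q) (β : ℝ) {s δ δ' : ℝ} (hs : 1 ≤ s)
    (h0 : 0 ≤ δ) (h : δ < δ') (h1 : δ' - δ ≤ 1) :
    pairENorm δ (s + 1) (GenCH.opB β p q) ≤ constB β s * (ENNReal.ofReal (1 / (δ' - δ)) *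
      (pairENorm δ' (s + 1) p * pairENorm δ' (s + 1) q)) := by
  have hd : 0 < δ' - δ := sub_pos.2 h
  set K := ENNReal.ofReal (1 / (δ' - δ)) with hK
  have hK1 : 1 ≤ K := by
    rw [hK, ← ENNReal.ofReal_one]
    exact ENNReal.ofReal_le_ofReal ((one_le_div hd).2 h1)
  set N := pairENorm δ' (s + 1) p
  set M := pairENorm δ' (s + 1) q
  set A := 8 * algebraConst s
  set A' := 8 * algebraConst (s + 1)
  have hs1 : 1 ≤ s + 1 := by linarith
  have hNM : N * M ≤ K * (N * M) := le_mul_of_one_le_left zero_le hK1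
  have low : ∀ f : ℝ → ℂ, eNormE δ s f ≤ eNormE δ (s + 1) f := fun f =>
    eNormE_mono_exponent (by linarith) f
  have p1 : eNormE δ (s + 1) p.1 ≤ N := (eNormE_mono h0 h.le _).trans (fst_le_pairENorm _ _ _)
  have p2 : eNormE δ (s + 1) p.2 ≤ N := (eNormE_mono h0 h.le _).trans (snd_le_pairENorm _ _ _)
  have q1 : eNormE δ (s + 1) q.1 ≤ M := (eNormE_mono h0 h.le _).trans (fst_le_pairENorm _ _ _)
  have q2 : eNormE δ (s + 1) q.2 ≤ M := (eNormE_mono h0 h.le _).trans (snd_le_pairENorm _ _ _)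
  have dp1 : eNormE δ (s + 1) (_root_.deriv p.1) ≤ K * N :=
    (eNormE_deriv_le h0 h _ _).trans (mul_le_mul_right (fst_le_pairENorm _ _ _) _)
  have dq1 : eNormE δ (s + 1) (_root_.deriv q.1) ≤ K * M :=
    (eNormE_deriv_le h0 h _ _).trans (mul_le_mul_right (fst_le_pairENorm _ _ _) _)
  have dq2 : eNormE δ (s + 1) (_root_.deriv q.2) ≤ K * M :=
    (eNormE_deriv_le h0 h _ _).trans (mul_le_mul_right (snd_le_pairENorm _ _ _) _)
  have hflux : eNormE δ s (GenCH.fluxB β p q) ≤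
      (‖(3 - (β : ℂ)) / 2‖ₑ + ‖(β : ℂ) / 2‖ₑ + ‖(1 / 2 : ℂ)‖ₑ) * A * (K * (N * M)) := by
    have b1 : eNormE δ s (p.1 * q.1) ≤ A * (N * M) :=
      (hp.fst.eNormE_mul_le hq.fst h0 hs).trans (mul_le_mul_right
        (mul_le_mul' ((low _).trans p1) ((low _).trans q1)) _)
    have b2 : eNormE δ s (_root_.deriv p.1 * _root_.deriv q.1) ≤ A * (N * M) :=
      (hp.fst.deriv.eNormE_mul_le hq.fst.deriv h0 hs).trans (mul_le_mul_right
        (mul_le_mul' ((hp.fst.eNormE_deriv_le δ s).trans p1)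
          ((hq.fst.eNormE_deriv_le δ s).trans q1)) _)
    have b3 : eNormE δ s (p.2 * q.2) ≤ A * (N * M) :=
      (hp.snd.eNormE_mul_le hq.snd h0 hs).trans (mul_le_mul_right
        (mul_le_mul' ((low _).trans p2) ((low _).trans q2)) _)
    have c1 := (hp.fst.mul hq.fst).smul ((3 - (β : ℂ)) / 2)
    have c2 := (hp.fst.deriv.mul hq.fst.deriv).smul ((β : ℂ) / 2)
    have c3 := (hp.snd.mul hq.snd).smul (1 / 2 : ℂ)
    calc _ ≤ ‖(3 - (β : ℂ)) / 2‖ₑ * (A * (N * M)) + ‖(β : ℂ) / 2‖ₑ * (A * (N * M)) +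
          ‖(1 / 2 : ℂ)‖ₑ * (A * (N * M)) := by
          refine (eNormE_add_le δ s (c1.add c2).contDiff c3.contDiff).trans (add_le_add
            ((eNormE_add_le δ s c1.contDiff c2.contDiff).trans (add_le_add ?_ ?_)) ?_)
          · exact (eNormE_smul_le _ _ _ _).trans (mul_le_mul_right b1 _)
          · exact (eNormE_smul_le _ _ _ _).trans (mul_le_mul_right b2 _)
          · exact (eNormE_smul_le _ _ _ _).trans (mul_le_mul_right b3 _)
      _ = (‖(3 - (β : ℂ)) / 2‖ₑ + ‖(β : ℂ) / 2‖ₑ + ‖(1 / 2 : ℂ)‖ₑ) * A * (N * M) := by ring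
      _ ≤ _ := mul_le_mul_right hNM _
  have e1 : eNormE δ (s + 1) (GenCH.opB β p q).1 ≤ ‖(β : ℂ)‖ₑ * (A' * (K * (N * M))) +
      (‖(3 - (β : ℂ)) / 2‖ₑ + ‖(β : ℂ) / 2‖ₑ + ‖(1 / 2 : ℂ)‖ₑ) * A * (K * (N * M)) := by
    refine (eNormE_neg_le _ _ _).trans ((eNormE_add_le δ (s + 1)
      ((hp.fst.mul hq.fst.deriv).smul _).contDiff (hp.fluxB β hq).helmDeriv.contDiff).trans
      (add_le_add ?_ (((hp.fluxB β hq).eNormE_helmDeriv_le δ s).trans hflux)))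
    refine (eNormE_smul_le _ _ _ _).trans (mul_le_mul_right
      ((hp.fst.eNormE_mul_le hq.fst.deriv h0 hs1).trans (mul_le_mul_right ?_ _)) _)
    calc _ ≤ N * (K * M) := mul_le_mul' p1 dq1
      _ = _ := by ring
  have e2 : eNormE δ (s + 1) (GenCH.opB β p q).2 ≤ 2 * (A' * (K * (N * M))) := by
    rw [two_mul]
    refine (eNormE_neg_le _ _ _).trans ((eNormE_add_le δ (s + 1)
      (hp.fst.deriv.mul hq.snd).contDiff (hp.fst.mul hq.snd.deriv).contDiff).trans
      (add_le_add ?_ ?_))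
    · refine (hp.fst.deriv.eNormE_mul_le hq.snd h0 hs1).trans (mul_le_mul_right ?_ _)
      calc _ ≤ (K * N) * M := mul_le_mul' dp1 q2
        _ = _ := by ring
    · refine (hp.fst.eNormE_mul_le hq.snd.deriv h0 hs1).trans (mul_le_mul_right ?_ _)
      calc _ ≤ N * (K * M) := mul_le_mul' p1 dq2
        _ = _ := by ring
  calc _ ≤ _ := add_le_add e1 e2
    _ = _ := by unfold constB; ring

lemma opL_add (α : ℝ) (hp : HInfPair p) (hq : HInfPair q) :
    GenCH.opL α (p + q) = GenCH.opL α p + GenCH.opL α q := by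
  have h : -(α : ℂ) • (p + q).1 + (p + q).2 =
      (-(α : ℂ) • p.1 + p.2) + (-(α : ℂ) • q.1 + q.2) := by
    simp only [Prod.fst_add, Prod.snd_add, smul_add]
    abel
  have hd : _root_.deriv (p.1 + q.1) = _root_.deriv p.1 + _root_.deriv q.1 := by
    ext x
    exact deriv_add (hp.fst.differentiable x) (hq.fst.differentiable x)
  refine Prod.ext ?_ ?_
  · simp only [GenCH.opL, Prod.fst_add]
    rw [← Prod.fst_add, h, ((hp.fst.smul _).add hp.snd).helmDeriv_add ((hq.fst.smul _).add hq.snd),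
      neg_add]
  · simp only [GenCH.opL, Prod.fst_add, Prod.snd_add]
    rw [hd, neg_add]

lemma opL_smul (α : ℝ) (c : ℂ) (hp : HInfPair p) :
    GenCH.opL α (c • p) = c • GenCH.opL α p := by
  have h : -(α : ℂ) • (c • p).1 + (c • p).2 = c • (-(α : ℂ) • p.1 + p.2) := by
    simp only [Prod.smul_fst, Prod.smul_snd, smul_add, smul_comm c]
  have hd : _root_.deriv (c • p.1) = c • _root_.deriv p.1 := by
    ext x
    exact deriv_const_smul c (hp.fst.differentiable x)
  refine Prod.ext ?_ ?_
  · simp only [GenCH.opL, Prod.smul_fst]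
    rw [← Prod.smul_fst, h, ((hp.fst.smul _).add hp.snd).helmDeriv_smul c, smul_neg]
  · simp only [GenCH.opL, Prod.smul_fst, Prod.smul_snd]
    rw [hd, smul_neg]

lemma opB_add_left (β : ℝ) (hp : HInfPair p) (hp' : HInfPair p') (hq : HInfPair q) :
    GenCH.opB β (p + p') q = GenCH.opB β p q + GenCH.opB β p' q := by
  have hd : _root_.deriv (p.1 + p'.1) = _root_.deriv p.1 + _root_.deriv p'.1 := by
    ext x
    exact deriv_add (hp.fst.differentiable x) (hp'.fst.differentiable x)
  have h : GenCH.fluxB β (p + p') q = GenCH.fluxB β p q + GenCH.fluxB β p' q := by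
    simp only [GenCH.fluxB, Prod.fst_add, Prod.snd_add, hd, add_mul, smul_add]
    abel
  refine Prod.ext ?_ ?_
  · simp only [GenCH.opB, Prod.fst_add]
    rw [h, (hp.fluxB β hq).helmDeriv_add (hp'.fluxB β hq), add_mul, smul_add]
    abel
  · simp only [GenCH.opB, Prod.fst_add, Prod.snd_add, hd, add_mul]
    abel

lemma opB_add_right (β : ℝ) (hp : HInfPair p) (hq : HInfPair q) (hq' : HInfPair q') :
    GenCH.opB β p (q + q') = GenCH.opB β p q + GenCH.opB β p q' := by
  have hd1 : _root_.deriv (q.1 + q'.1) = _root_.deriv q.1 + _root_.deriv q'.1 := by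
    ext x
    exact deriv_add (hq.fst.differentiable x) (hq'.fst.differentiable x)
  have hd2 : _root_.deriv (q.2 + q'.2) = _root_.deriv q.2 + _root_.deriv q'.2 := by
    ext x
    exact deriv_add (hq.snd.differentiable x) (hq'.snd.differentiable x)
  have h : GenCH.fluxB β p (q + q') = GenCH.fluxB β p q + GenCH.fluxB β p q' := by
    simp only [GenCH.fluxB, Prod.fst_add, Prod.snd_add, hd1, mul_add, smul_add]
    abel
  refine Prod.ext ?_ ?_
  · simp only [GenCH.opB, Prod.fst_add]
    rw [h, (hp.fluxB β hq).helmDeriv_add (hp.fluxB β hq'), hd1, mul_add, smul_add]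
    abel
  · simp only [GenCH.opB, Prod.snd_add, hd2, mul_add]
    abel

lemma opB_smul_left (β : ℝ) (c : ℂ) (hp : HInfPair p) (hq : HInfPair q) :
    GenCH.opB β (c • p) q = c • GenCH.opB β p q := by
  have hd : _root_.deriv (c • p.1) = c • _root_.deriv p.1 := by
    ext x
    exact deriv_const_smul c (hp.fst.differentiable x)
  have h : GenCH.fluxB β (c • p) q = c • GenCH.fluxB β p q := by
    simp only [GenCH.fluxB, Prod.smul_fst, Prod.smul_snd, hd, smul_mul_assoc, smul_add, smul_comm c]
  refine Prod.ext ?_ ?_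
  · simp only [GenCH.opB, Prod.smul_fst]
    rw [h, (hp.fluxB β hq).helmDeriv_smul, smul_mul_assoc, smul_neg, smul_add, smul_comm c]
  · simp only [GenCH.opB, Prod.smul_fst, Prod.smul_snd, hd, smul_mul_assoc, smul_neg, smul_add]

lemma opB_smul_right (β : ℝ) (c : ℂ) (hp : HInfPair p) (hq : HInfPair q) :
    GenCH.opB β p (c • q) = c • GenCH.opB β p q := by
  have hd1 : _root_.deriv (c • q.1) = c • _root_.deriv q.1 := by
    ext x
    exact deriv_const_smul c (hq.fst.differentiable x)
  have hd2 : _root_.deriv (c • q.2) = c • _root_.deriv q.2 := by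
    ext x
    exact deriv_const_smul c (hq.snd.differentiable x)
  have h : GenCH.fluxB β p (c • q) = c • GenCH.fluxB β p q := by
    simp only [GenCH.fluxB, Prod.smul_fst, Prod.smul_snd, hd1, mul_smul_comm, smul_add,
      smul_comm c]
  refine Prod.ext ?_ ?_
  · simp only [GenCH.opB, Prod.smul_fst]
    rw [h, (hp.fluxB β hq).helmDeriv_smul, hd1, mul_smul_comm, smul_neg, smul_add, smul_comm c]
  · simp only [GenCH.opB, Prod.smul_snd, hd2, mul_smul_comm, smul_neg, smul_add]

end HInfPair

/-! ### Pairs of real-valued functions -/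

/-- Both components are real-valued. -/
def IsRealPair (p : (ℝ → ℂ) × (ℝ → ℂ)) : Prop := ∀ x, (p.1 x).im = 0 ∧ (p.2 x).im = 0

lemma deriv_im_eq_zero {f : ℝ → ℂ} (hf : Differentiable ℝ f) (hr : ∀ x, (f x).im = 0) (x : ℝ) :
    (deriv f x).im = 0 := by
  have h : HasDerivAt (fun y => (f y).im) (deriv f x).im x :=
    (Complex.imCLM.hasFDerivAt.comp_hasDerivAt x (hf x).hasDerivAt)
  simp only [hr] at h
  exact h.unique (hasDerivAt_const x 0)

namespace IsRealPair

variable {p q : (ℝ → ℂ) × (ℝ → ℂ)}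

lemma opL (α : ℝ) (hp : HInfPair p) (h : IsRealPair p) : IsRealPair (opL α p) := by
  intro x
  constructor
  · have := ((hp.fst.smul (-(α : ℂ))).add hp.snd).helmDeriv_im_eq_zero (fun y => by
      simp [(h y).1, (h y).2]) x
    simpa [GenCH.opL] using this
  · simpa [GenCH.opL] using deriv_im_eq_zero hp.fst.differentiable (fun y => (h y).1) x

lemma opB (β : ℝ) (hp : HInfPair p) (hq : HInfPair q) (h : IsRealPair p) (h' : IsRealPair q) :
    IsRealPair (opB β p q) := by
  have d1 := deriv_im_eq_zero hp.fst.differentiable fun y => (h y).1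
  have d2 := deriv_im_eq_zero hq.fst.differentiable fun y => (h' y).1
  have d3 := deriv_im_eq_zero hq.snd.differentiable fun y => (h' y).2
  have c1 : ((3 - (β : ℂ)) / 2).im = 0 := by
    rw [show (3 - (β : ℂ)) / 2 = (((3 - β) / 2 : ℝ) : ℂ) by push_cast; ring, Complex.ofReal_im]
  have c2 : ((β : ℂ) / 2).im = 0 := by
    rw [show (β : ℂ) / 2 = ((β / 2 : ℝ) : ℂ) by push_cast; ring, Complex.ofReal_im]
  have c3 : (1 / 2 : ℂ).im = 0 := by
    rw [show (1 / 2 : ℂ) = ((1 / 2 : ℝ) : ℂ) by push_cast; ring, Complex.ofReal_im]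
  intro x
  constructor
  · have hf := (hp.fluxB β hq).helmDeriv_im_eq_zero (fun y => by
      simp only [GenCH.fluxB, Pi.add_apply, Pi.smul_apply, Pi.mul_apply, smul_eq_mul,
        Complex.add_im, Complex.mul_im, c1, c2, c3, d1, d2, (h y).1, (h y).2, (h' y).1, (h' y).2]
      ring) x
    simp only [GenCH.opB, Pi.neg_apply, Pi.add_apply, Pi.smul_apply, Pi.mul_apply, smul_eq_mul,
      Complex.neg_im, Complex.add_im, Complex.mul_im, hf, d2, (h x).1, Complex.ofReal_im]
    ring
  · simp only [GenCH.opB, Pi.neg_apply, Pi.add_apply, Pi.mul_apply,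
      Complex.neg_im, Complex.add_im, Complex.mul_im, d1, d3, (h x).1, (h' x).2]
    ring

end IsRealPair

/-! ### The system as a family of scalar quadratic equations -/

section Functionals

/-- The value at the point `j.1` of the first or second component of a pair, according to `j.2`. -/
def evalPair (j : ℝ × Bool) : ((ℝ → ℂ) × (ℝ → ℂ)) →ₗ[ℂ] ℂ where
  toFun p := cond j.2 (p.1 j.1) (p.2 j.1)
  map_add' p q := by cases j.2 <;> rfl
  map_smul' c p := by cases j.2 <;> rfl

@[simp] lemma evalPair_true (x : ℝ) (p : (ℝ → ℂ) × (ℝ → ℂ)) : evalPair (x, true) p = p.1 x := rfl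

@[simp] lemma evalPair_false (x : ℝ) (p : (ℝ → ℂ) × (ℝ → ℂ)) : evalPair (x, false) p = p.2 x := rfl

lemma HInfPair.enorm_evalPair_le {p : (ℝ → ℂ) × (ℝ → ℂ)} (hp : HInfPair p) {s : ℝ} (hs : 1 ≤ s)
    (δ : ℝ) (j : ℝ × Bool) : ‖evalPair j p‖ₑ ≤ sobolevConst * pairENorm δ s p := by
  obtain ⟨x, b⟩ := j
  cases b
  · exact (hp.snd.enorm_le_eNormE hs δ x).trans (mul_le_mul_right (snd_le_pairENorm _ _ _) _)
  · exact (hp.fst.enorm_le_eNormE hs δ x).trans (mul_le_mul_right (fst_le_pairENorm _ _ _) _)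

variable {δ s : ℝ}

/-- The pair of functions underlying an element of `E_{δ,s} ⊕ E_{δ,s}`. -/
def toPair : EC δ s × EC δ s →ₗ[ℂ] (ℝ → ℂ) × (ℝ → ℂ) where
  toFun U := (U.1, U.2)
  map_add' _ _ := rfl
  map_smul' _ _ := rfl

lemma hInfPair_toPair (hδ : 0 < δ) (U : EC δ s × EC δ s) : HInfPair (toPair U) :=
  ⟨EC.hInf hδ U.1, EC.hInf hδ U.2⟩

lemma pairENorm_toPair (U : EC δ s × EC δ s) : pairENorm δ s (toPair U) = ‖U.1‖ₑ + ‖U.2‖ₑ := by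
  rw [EC.enorm_eq, EC.enorm_eq]
  rfl

lemma pairENorm_toPair_le (U : EC δ s × EC δ s) : pairENorm δ s (toPair U) ≤ 2 * ‖U‖ₑ := by
  rw [pairENorm_toPair, two_mul, ← ofReal_norm, ← ofReal_norm, ← ofReal_norm]
  exact add_le_add (ENNReal.ofReal_le_ofReal (norm_fst_le U))
    (ENNReal.ofReal_le_ofReal (norm_snd_le U))

lemma norm_le_toReal_mul {X : Type*} [NormedAddCommGroup X] {z : ℂ} {c : ℝ≥0∞} (hc : c ≠ ⊤) {x : X}
    (h : ‖z‖ₑ ≤ c * ‖x‖ₑ) : ‖z‖ ≤ c.toReal * ‖x‖ := by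
  rw [← toReal_enorm, ← toReal_enorm x, ← ENNReal.toReal_mul]
  exact ENNReal.toReal_mono (ENNReal.mul_ne_top hc enorm_ne_top) h

lemma norm_le_toReal_mul_mul {X : Type*} [NormedAddCommGroup X] {z : ℂ} {c : ℝ≥0∞} (hc : c ≠ ⊤)
    {x y : X} (h : ‖z‖ₑ ≤ c * (‖x‖ₑ * ‖y‖ₑ)) : ‖z‖ ≤ c.toReal * ‖x‖ * ‖y‖ := by
  rw [← toReal_enorm, ← toReal_enorm x, ← toReal_enorm y, mul_assoc, ← ENNReal.toReal_mul,
    ← ENNReal.toReal_mul]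
  exact ENNReal.toReal_mono
    (ENNReal.mul_ne_top hc (ENNReal.mul_ne_top enorm_ne_top enorm_ne_top)) h

/-- `evalPair j` as a continuous functional on `E_{δ,s} ⊕ E_{δ,s}`. -/
noncomputable def evalCLM (hδ : 0 < δ) (hs : 1 ≤ s) (j : ℝ × Bool) : EC δ s × EC δ s →L[ℂ] ℂ :=
  ((evalPair j).comp toPair).mkContinuous (sobolevConst * 2).toReal fun U => by
    refine norm_le_toReal_mul (ENNReal.mul_ne_top sobolevConst_lt_top.ne (by simp)) ?_
    refine ((hInfPair_toPair hδ U).enorm_evalPair_le hs δ j).trans ?_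
    rw [mul_assoc]
    exact mul_le_mul_right (pairENorm_toPair_le U) _

@[simp] lemma evalCLM_apply (hδ : 0 < δ) (hs : 1 ≤ s) (j : ℝ × Bool) (U : EC δ s × EC δ s) :
    evalCLM hδ hs j U = evalPair j (toPair U) := rfl

lemma eq_zero_of_evalCLM (hδ : 0 < δ) (hs : 1 ≤ s) (U : EC δ s × EC δ s)
    (h : ∀ j, evalCLM hδ hs j U = 0) : U = 0 :=
  Prod.ext (Subtype.ext (funext fun x => h (x, true))) (Subtype.ext (funext fun x => h (x, false)))

/-- The value of `opL` as a continuous functional on `E_{δ,s+1} ⊕ E_{δ,s+1}`. -/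
noncomputable def opLCLM (α : ℝ) (hδ : 0 < δ) (hδ1 : δ < 1) (hs : 1 ≤ s) (j : ℝ × Bool) :
    EC δ (s + 1) × EC δ (s + 1) →L[ℂ] ℂ :=
  LinearMap.mkContinuous
    { toFun := fun U => evalPair j (opL α (toPair U))
      map_add' := fun U V => by
        rw [map_add, (hInfPair_toPair hδ U).opL_add α (hInfPair_toPair hδ V), map_add]
      map_smul' := fun c U => by
        rw [map_smul, (hInfPair_toPair hδ U).opL_smul α c, map_smul, RingHom.id_apply] }
    -- The loss estimate sends radius `δ` to any smaller one; `δ/2` serves, since point evaluation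
    -- is continuous there too. The factor `2` compares the sum of the component norms with the
    -- maximum norm of the product space.
    (sobolevConst * ((‖(α : ℂ)‖ₑ + 2) * (ENNReal.ofReal (1 / (δ - δ / 2)) * 2))).toReal fun U => by
      have hC := sobolevConst_lt_top.ne
      refine norm_le_toReal_mul (by finiteness) ?_
      have hU := hInfPair_toPair hδ U
      refine ((hU.opL α).enorm_evalPair_le (s := s + 1) (by linarith) (δ / 2) j).trans ?_
      rw [mul_assoc, mul_assoc, mul_assoc]
      refine mul_le_mul_right ((hU.pairENorm_opL_le α (s := s) (δ := δ / 2) (δ' := δ) (by linarith)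
        (by linarith) (by linarith)).trans ?_) _
      exact mul_le_mul_right (mul_le_mul_right (pairENorm_toPair_le U) _) _

@[simp] lemma opLCLM_apply (α : ℝ) (hδ : 0 < δ) (hδ1 : δ < 1) (hs : 1 ≤ s) (j : ℝ × Bool)
    (U : EC δ (s + 1) × EC δ (s + 1)) :
    opLCLM α hδ hδ1 hs j U = evalPair j (opL α (toPair U)) := rfl

/-- The value of `opB` as a continuous bilinear form on `E_{δ,s+1} ⊕ E_{δ,s+1}`. -/
noncomputable def opBCLM (β : ℝ) (hδ : 0 < δ) (hδ1 : δ < 1) (hs : 1 ≤ s) (j : ℝ × Bool) :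
    EC δ (s + 1) × EC δ (s + 1) →L[ℂ] EC δ (s + 1) × EC δ (s + 1) →L[ℂ] ℂ :=
  LinearMap.mkContinuous₂
    (LinearMap.mk₂ ℂ (fun U V => evalPair j (opB β (toPair U) (toPair V)))
      (fun U U' V => by
        rw [map_add, (hInfPair_toPair hδ U).opB_add_left β (hInfPair_toPair hδ U')
          (hInfPair_toPair hδ V), map_add])
      (fun c U V => by
        rw [map_smul, (hInfPair_toPair hδ U).opB_smul_left β c (hInfPair_toPair hδ V), map_smul])
      (fun U V V' => by
        rw [map_add, (hInfPair_toPair hδ U).opB_add_right β (hInfPair_toPair hδ V)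
          (hInfPair_toPair hδ V'), map_add])
      (fun c U V => by
        rw [map_smul, (hInfPair_toPair hδ U).opB_smul_right β c (hInfPair_toPair hδ V), map_smul]))
    -- Again through radius `δ/2`; here `4 = 2 · 2`, one factor for each argument.
    (sobolevConst * (HInfPair.constB β s * (ENNReal.ofReal (1 / (δ - δ / 2)) * 4))).toReal fun U V => by
      have hC := sobolevConst_lt_top.ne
      have hB := (HInfPair.constB_lt_top β s).ne
      refine norm_le_toReal_mul_mul (by finiteness) ?_
      have hU := hInfPair_toPair hδ U
      have hV := hInfPair_toPair hδ V
      refine ((hU.opB β hV).enorm_evalPair_le (s := s + 1) (by linarith) (δ / 2) j).trans ?_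
      rw [mul_assoc, mul_assoc, mul_assoc]
      refine mul_le_mul_right ((hU.pairENorm_opB_le hV β hs (δ := δ / 2) (δ' := δ) (by linarith)
        (by linarith) (by linarith)).trans ?_) _
      refine mul_le_mul_right (mul_le_mul_right ?_ _) _
      refine (mul_le_mul' (pairENorm_toPair_le U) (pairENorm_toPair_le V)).trans (le_of_eq ?_)
      ring

@[simp] lemma opBCLM_apply (β : ℝ) (hδ : 0 < δ) (hδ1 : δ < 1) (hs : 1 ≤ s) (j : ℝ × Bool)
    (U V : EC δ (s + 1) × EC δ (s + 1)) :
    opBCLM β hδ hδ1 hs j U V = evalPair j (opB β (toPair U) (toPair V)) := rfl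

/-- Translates the Cauchy problem into the abstract quadratic setting: the index `j` runs over the
points `x` and the two equations, and the flux splits into its linear and quadratic parts. -/
lemma isHolomorphicSolution_iff (α β : ℝ) (hδ : 0 < δ) (hδ1 : δ < 1) (hs : 1 ≤ s)
    (hs1 : 1 ≤ s + 1) (u₀ v₀ : ℝ → ℂ) (r : ℝ) (U : ℂ → EC δ (s + 1) × EC δ (s + 1)) :
    IsHolomorphicSolution α β u₀ v₀ r U ↔ toPair (U 0) = (u₀, v₀) ∧
      IsQuadraticSolution (evalCLM hδ hs1) (opLCLM α hδ hδ1 hs) (opBCLM β hδ hδ1 hs) r U := by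
  have key : ∀ t : ℂ, ((∀ x : ℝ, (deriv U t).1 x + (β : ℂ) * (U t).1 x * deriv (U t).1 x
      + invHelmholtz (deriv fun y : ℝ =>
          -(α : ℂ) * (U t).1 y + (3 - (β : ℂ)) / 2 * (U t).1 y ^ 2
            + (β : ℂ) / 2 * (deriv (U t).1 y) ^ 2 + (U t).2 y + 1 / 2 * (U t).2 y ^ 2) x = 0) ∧
      (∀ x : ℝ, (deriv U t).2 x + deriv (U t).1 x +
        deriv (fun y : ℝ => (U t).1 y * (U t).2 y) x = 0)) ↔
      ∀ j, evalCLM hδ hs1 j (deriv U t) = opLCLM α hδ hδ1 hs j (U t) +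
        opBCLM β hδ hδ1 hs j (U t) (U t) := by
    intro t
    set u := (U t).1
    set v := (U t).2
    have hp := hInfPair_toPair hδ (U t)
    have hflux : (fun y : ℝ => -(α : ℂ) * u y + (3 - (β : ℂ)) / 2 * u y ^ 2
            + (β : ℂ) / 2 * (deriv u y) ^ 2 + v y + 1 / 2 * v y ^ 2) =
        (-(α : ℂ) • (toPair (U t)).1 + (toPair (U t)).2) + fluxB β (toPair (U t)) (toPair (U t)) := by
      ext y
      simp only [fluxB, Pi.add_apply, Pi.smul_apply, Pi.mul_apply, smul_eq_mul]
      change _ = -(α : ℂ) * u y + v y + ((3 - (β : ℂ)) / 2 * (u y * u y) +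
        (β : ℂ) / 2 * (deriv u y * deriv u y) + 1 / 2 * (v y * v y))
      ring
    have hH := ((hp.fst.smul (-(α : ℂ))).add hp.snd).helmDeriv_add (hp.fluxB β hp)
    have hmul : ∀ x, deriv (fun y : ℝ => u y * v y) x = deriv u x * v x + u x * deriv v x :=
      fun x => deriv_fun_mul (hp.fst.differentiable x) (hp.snd.differentiable x)
    rw [hflux]
    change ((∀ x, (deriv U t).1 x + (β : ℂ) * u x * deriv u x + helmDeriv _ x = 0) ∧ _) ↔ _
    rw [hH]
    simp only [hmul, Prod.forall, Bool.forall_bool, evalCLM_apply, opLCLM_apply, opBCLM_apply,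
      evalPair_true, evalPair_false, opL, opB, Pi.neg_apply, Pi.add_apply, Pi.smul_apply,
      Pi.mul_apply, smul_eq_mul]
    constructor
    · rintro ⟨h1, h2⟩ x
      constructor
      · change (deriv U t).2 x = -deriv u x + -(deriv u x * v x + u x * deriv v x)
        linear_combination h2 x
      · change (deriv U t).1 x = -helmDeriv _ x + -((β : ℂ) * (u x * deriv u x) + helmDeriv _ x)
        linear_combination h1 x
    · intro h
      refine ⟨fun x => ?_, fun x => ?_⟩
      · have : (deriv U t).1 x = -helmDeriv _ x + -((β : ℂ) * (u x * deriv u x) + helmDeriv _ x) :=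
          (h x).2
        linear_combination this
      · have : (deriv U t).2 x = -deriv u x + -(deriv u x * v x + u x * deriv v x) := (h x).1
        linear_combination this
  constructor
  · intro h
    exact ⟨Prod.ext (funext h.init_u) (funext h.init_v), h.holomorphic,
      fun t ht => (key t).1 ⟨h.eq_u t ht, h.eq_v t ht⟩⟩
  · rintro ⟨h0, h⟩
    exact ⟨h.holomorphic, fun x => congrFun (congrArg Prod.fst h0) x,
      fun x => congrFun (congrArg Prod.snd h0) x, fun t ht => ((key t).2 (h.eq t ht)).1,
      fun t ht => ((key t).2 (h.eq t ht)).2⟩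

end Functionals

/-! ### The Taylor coefficients of the solution -/

/-- The Taylor coefficients at `t = 0` of the solution with initial value `p`. -/
noncomputable def taylorCoeff (α β : ℝ) (p : (ℝ → ℂ) × (ℝ → ℂ)) : ℕ → (ℝ → ℂ) × (ℝ → ℂ)
  | 0 => p
  | n + 1 => ((n : ℂ) + 1)⁻¹ • (opL α (taylorCoeff α β p n) +
      ∑ i : Fin (n + 1), opB β (taylorCoeff α β p i) (taylorCoeff α β p (n - i)))
  decreasing_by all_goals omega

lemma taylorCoeff_zero (α β : ℝ) (p : (ℝ → ℂ) × (ℝ → ℂ)) : taylorCoeff α β p 0 = p := by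
  rw [taylorCoeff]

lemma taylorCoeff_succ (α β : ℝ) (p : (ℝ → ℂ) × (ℝ → ℂ)) (n : ℕ) :
    taylorCoeff α β p (n + 1) = ((n : ℂ) + 1)⁻¹ • (opL α (taylorCoeff α β p n) +
      ∑ q ∈ Finset.HasAntidiagonal.antidiagonal n,
        opB β (taylorCoeff α β p q.1) (taylorCoeff α β p q.2)) := by
  rw [taylorCoeff, Finset.Nat.sum_antidiagonal_eq_sum_range_succ
    (fun i j => opB β (taylorCoeff α β p i) (taylorCoeff α β p j)) n, Finset.sum_range]

/-- The sum of the constants in the estimates of `opL` and `opB`. -/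
noncomputable def estConst (α β s : ℝ) : ℝ :=
  ((‖(α : ℂ)‖ₑ + 2) + HInfPair.constB β s).toReal

lemma estConst_ne_top (α β s : ℝ) : (‖(α : ℂ)‖ₑ + 2) + HInfPair.constB β s ≠ ⊤ := by
  have := (HInfPair.constB_lt_top β s).ne
  finiteness

lemma estConst_pos (α β s : ℝ) : 0 < estConst α β s := by
  refine ENNReal.toReal_pos ?_ (estConst_ne_top α β s)
  simp

/-- The reciprocal of the lifespan as a function of the size of the data. -/
noncomputable def rate (α β s N : ℝ) : ℝ := 216 * estConst α β s * (1 + N)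

/-- This is `(1 + 1/(n+1))^n ≤ e < 3`, the cost in the `n`-th majorant of replacing `δ` by `δ +
(1-δ)/(n+2)`. -/
lemma one_add_one_div_pow_le_three (n : ℕ) :
    (((n : ℝ) + 2) / ((n : ℝ) + 1)) ^ n ≤ 3 := by
  have hn : (0 : ℝ) < (n : ℝ) + 1 := by positivity
  have h1 : ((n : ℝ) + 2) / ((n : ℝ) + 1) = 1 / ((n : ℝ) + 1) + 1 := by field_simp; ring
  calc (((n : ℝ) + 2) / ((n : ℝ) + 1)) ^ n
      ≤ (Real.exp (1 / ((n : ℝ) + 1))) ^ n := by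
        rw [h1]
        gcongr
        exact Real.add_one_le_exp _
    _ = Real.exp ((n : ℝ) * (1 / ((n : ℝ) + 1))) := (Real.exp_nat_mul _ _).symm
    _ ≤ Real.exp 1 := by
        gcongr
        rw [mul_one_div, div_le_one hn]
        linarith
    _ ≤ 3 := by linarith [Real.exp_one_lt_d9]

/-! ### Majorants for the Taylor coefficients -/

/-- The bound for the `n`-th Taylor coefficient in the norm `‖·‖_(δ,s)`. -/
noncomputable def majorant (A K δ : ℝ) (n : ℕ) : ℝ :=
  A * K ^ n / (1 - δ) ^ n * (1 / ((n : ℝ) + 1) ^ 2)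

lemma majorant_nonneg {A K δ : ℝ} (hA : 0 ≤ A) (hK : 0 ≤ K) (hδ : δ < 1) (n : ℕ) :
    0 ≤ majorant A K δ n := by
  have : 0 < 1 - δ := by linarith
  unfold majorant
  positivity

/-- The geometric factors multiply exactly, and the factors `1/(n+1)²` are stable under convolution
with constant `8`. -/
lemma sum_majorant_le {A K δ : ℝ} (hK : 0 ≤ K) (hδ : δ < 1) (n : ℕ) :
    ∑ q ∈ Finset.HasAntidiagonal.antidiagonal n, majorant A K δ q.1 * majorant A K δ q.2 ≤
      8 * A * majorant A K δ n := by
  have hd : 0 < 1 - δ := by linarith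
  have h : ∀ q ∈ Finset.HasAntidiagonal.antidiagonal n,
      majorant A K δ q.1 * majorant A K δ q.2 = A ^ 2 * K ^ n / (1 - δ) ^ n *
        (1 / ((q.1 : ℝ) + 1) ^ 2 * (1 / ((q.2 : ℝ) + 1) ^ 2)) := by
    intro q hq
    rw [← Finset.HasAntidiagonal.mem_antidiagonal.1 hq, pow_add, pow_add]
    unfold majorant
    field_simp
  rw [Finset.sum_congr rfl h, ← Finset.mul_sum]
  calc _ ≤ A ^ 2 * K ^ n / (1 - δ) ^ n * (8 * (1 / ((n : ℝ) + 1) ^ 2)) := by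
        gcongr
        exact sum_antidiagonal_inv_sq_le n
    _ = _ := by unfold majorant; ring

/-- The recursion closes, and `216 = 9 · 3 · 8`. The `9` is `1 + 8` from the linear and the bilinear
terms, where `1 ≤ A` lets `A` absorb the linear one; the `3` bounds the change of radius; the `8`
comes from `(n+2)³ ≤ 8 (n+1)³`. -/
lemma majorant_step {A C δ : ℝ} (hA : 1 ≤ A) (hC : 0 ≤ C) (hδ : δ < 1) (n : ℕ) :
    ((n : ℝ) + 1)⁻¹ * (C * (((n : ℝ) + 2) / (1 - δ)) *
      (9 * A * majorant A (216 * C * A) (δ + (1 - δ) / ((n : ℝ) + 2)) n)) ≤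
      majorant A (216 * C * A) δ (n + 1) := by
  have hd : 0 < 1 - δ := by linarith
  have hn : (0 : ℝ) ≤ n := Nat.cast_nonneg n
  set K := 216 * C * A with hK
  have hK0 : 0 ≤ K := by positivity
  -- Spending the fraction `1/(n+2)` of the remaining radius leaves the fraction `(n+1)/(n+2)`,
  -- whose `n`-th power stays bounded below.
  have hδ' : 1 - (δ + (1 - δ) / ((n : ℝ) + 2)) = (1 - δ) * (((n : ℝ) + 1) / ((n : ℝ) + 2)) := by
    field_simp
    ring
  have e1 : majorant A K (δ + (1 - δ) / ((n : ℝ) + 2)) n =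
      (((n : ℝ) + 2) / ((n : ℝ) + 1)) ^ n * majorant A K δ n := by
    unfold majorant
    rw [hδ', mul_pow (1 - δ), div_pow, div_pow]
    field_simp
  have e3 : majorant A K (δ + (1 - δ) / ((n : ℝ) + 2)) n ≤ 3 * majorant A K δ n := by
    rw [e1]
    exact mul_le_mul_of_nonneg_right (one_add_one_div_pow_le_three n)
      (majorant_nonneg (by linarith) hK0 hδ n)
  calc _ ≤ ((n : ℝ) + 1)⁻¹ * (C * (((n : ℝ) + 2) / (1 - δ)) *
      (9 * A * (3 * majorant A K δ n))) := by gcongr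
    _ = A * K ^ n * (C * A) / (1 - δ) ^ (n + 1) * (27 * (((n : ℝ) + 2) / ((n : ℝ) + 1) ^ 3)) := by
      unfold majorant
      field_simp
      ring
    _ ≤ A * K ^ n * (C * A) / (1 - δ) ^ (n + 1) * (216 * (1 / ((n : ℝ) + 2) ^ 2)) := by
      gcongr ?_ * ?_
      rw [mul_div_assoc', mul_div_assoc', div_le_div_iff₀ (by positivity) (by positivity)]
      have : ((n : ℝ) + 2) ^ 3 ≤ (2 * ((n : ℝ) + 1)) ^ 3 := by
        gcongr
        linarith
      nlinarith
    _ = majorant A K δ (n + 1) := by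
      unfold majorant
      rw [pow_succ K n]
      conv_rhs => rw [hK]
      rw [← hK]
      push_cast
      ring

/-- The induction must treat all `δ < 1` at once, since the bound for one coefficient at `δ` uses
those for its predecessors at a larger radius. Taking `1 + N` in place of `N` keeps the amplitude at
least `1`, as `majorant_step` requires. -/
lemma taylorCoeff_estimate (α β : ℝ) {s : ℝ} (hs : 1 ≤ s) {p : (ℝ → ℂ) × (ℝ → ℂ)} {N : ℝ}
    (hN : 0 ≤ N) (hp : HInfPair p) (hr : IsRealPair p)
    (hb : pairENorm 1 (s + 1) p ≤ ENNReal.ofReal N) (n : ℕ) :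
    HInfPair (taylorCoeff α β p n) ∧ IsRealPair (taylorCoeff α β p n) ∧
      ∀ δ : ℝ, 0 < δ → δ < 1 → pairENorm δ (s + 1) (taylorCoeff α β p n) ≤
        ENNReal.ofReal (majorant (1 + N) (rate α β s N) δ n) := by
  induction n using Nat.strong_induction_on with
  | _ n ih =>
  cases n with
  | zero =>
    rw [taylorCoeff_zero]
    refine ⟨hp, hr, fun δ h0 h1 => (pairENorm_mono h0.le h1.le p).trans (hb.trans
      (ENNReal.ofReal_le_ofReal ?_))⟩
    simp [majorant]
  | succ n =>
    have ih1 : ∀ q ∈ Finset.HasAntidiagonal.antidiagonal n, q.1 < n + 1 ∧ q.2 < n + 1 := by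
      intro q hq
      have := Finset.HasAntidiagonal.mem_antidiagonal.1 hq
      omega
    set a := taylorCoeff α β p with ha
    have hL := (ih n (Nat.lt_succ_self n)).1.opL α
    have hBmem : ∀ q ∈ Finset.HasAntidiagonal.antidiagonal n, HInfPair (opB β (a q.1) (a q.2)) :=
      fun q hq => (ih _ (ih1 q hq).1).1.opB β (ih _ (ih1 q hq).2).1
    have hsum := fun δ => HInfPair.pairENorm_sum_le _ hBmem δ (s + 1)
    rw [ha, taylorCoeff_succ, ← ha]
    refine ⟨(hL.add (hsum 1).1).smul _, ?_, fun δ h0 h1 => ?_⟩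
    · intro x
      have hLr := IsRealPair.opL α (ih n (Nat.lt_succ_self n)).1 (ih n (Nat.lt_succ_self n)).2.1 x
      have hBr : ∀ q ∈ Finset.HasAntidiagonal.antidiagonal n,
          IsRealPair (opB β (a q.1) (a q.2)) := fun q hq =>
        IsRealPair.opB β (ih _ (ih1 q hq).1).1 (ih _ (ih1 q hq).2).1
          (ih _ (ih1 q hq).1).2.1 (ih _ (ih1 q hq).2).2.1
      have hc : (((n : ℂ) + 1)⁻¹).im = 0 := by
        rw [show ((n : ℂ) + 1)⁻¹ = ((((n : ℝ) + 1)⁻¹ : ℝ) : ℂ) by push_cast; rfl,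
          Complex.ofReal_im]
      have hS1 : ((∑ q ∈ Finset.HasAntidiagonal.antidiagonal n, opB β (a q.1) (a q.2)).1 x).im
          = 0 := by
        rw [Prod.fst_sum, Finset.sum_apply, Complex.im_sum]
        exact Finset.sum_eq_zero fun q hq => (hBr q hq x).1
      have hS2 : ((∑ q ∈ Finset.HasAntidiagonal.antidiagonal n, opB β (a q.1) (a q.2)).2 x).im
          = 0 := by
        rw [Prod.snd_sum, Finset.sum_apply, Complex.im_sum]
        exact Finset.sum_eq_zero fun q hq => (hBr q hq x).2
      constructor
      · simp only [Prod.smul_fst, Prod.fst_add, Pi.smul_apply, Pi.add_apply, smul_eq_mul,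
          Complex.mul_im, Complex.add_im, hc, hLr.1, hS1]
        ring
      · simp only [Prod.smul_snd, Prod.snd_add, Pi.smul_apply, Pi.add_apply, smul_eq_mul,
          Complex.mul_im, Complex.add_im, hc, hLr.2, hS2]
        ring
    · have hd : 0 < 1 - δ := by linarith
      -- The intermediate radius makes the derivative loss `(n+2)/(1-δ)`; the factor `1/(n+1)` from
      -- the recursion compensates its growth in `n`.
      set δ' := δ + (1 - δ) / ((n : ℝ) + 2) with hδ'
      have hq : 0 < (1 - δ) / ((n : ℝ) + 2) := by positivity
      have hδδ' : δ < δ' := by linarith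
      have hlt : (1 - δ) / ((n : ℝ) + 2) < 1 - δ :=
        div_lt_self hd (by linarith [(Nat.cast_nonneg n : (0 : ℝ) ≤ n)])
      have hδ'1 : δ' < 1 := by linarith
      have hinv : 1 / (δ' - δ) = ((n : ℝ) + 2) / (1 - δ) := by
        rw [hδ', add_sub_cancel_left, one_div_div]
      set A := 1 + N
      set K := rate α β s N with hK
      have hA : 1 ≤ A := by simp only [A]; linarith
      have hC := (estConst_pos α β s).le
      have hK0 : 0 ≤ K := by rw [hK, rate]; positivity
      have hmaj := fun i => majorant_nonneg (zero_le_one.trans hA) hK0 hδ'1 i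
      set c := ENNReal.ofReal (1 / (δ' - δ)) with hc
      set C := (‖(α : ℂ)‖ₑ + 2) + HInfPair.constB β s with hCdef
      have hCe : C = ENNReal.ofReal (estConst α β s) :=
        (ENNReal.ofReal_toReal (estConst_ne_top α β s)).symm
      have bL : pairENorm δ (s + 1) (opL α (a n)) ≤ C * (c * ENNReal.ofReal (majorant A K δ' n)) :=
        ((ih n (Nat.lt_succ_self n)).1.pairENorm_opL_le α h0.le hδδ' (by linarith)).trans
          (mul_le_mul' le_self_add (mul_le_mul_right
            ((ih n (Nat.lt_succ_self n)).2.2 δ' (h0.trans hδδ') hδ'1) _))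
      have bB : ∀ q ∈ Finset.HasAntidiagonal.antidiagonal n,
          pairENorm δ (s + 1) (opB β (a q.1) (a q.2)) ≤
            C * (c * ENNReal.ofReal (majorant A K δ' q.1 * majorant A K δ' q.2)) := by
        intro q hq
        refine ((ih _ (ih1 q hq).1).1.pairENorm_opB_le (ih _ (ih1 q hq).2).1 β hs h0.le hδδ'
          (by linarith)).trans (mul_le_mul' le_add_self (mul_le_mul_right ?_ _))
        rw [ENNReal.ofReal_mul (hmaj _)]
        exact mul_le_mul' ((ih _ (ih1 q hq).1).2.2 δ' (h0.trans hδδ') hδ'1)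
          ((ih _ (ih1 q hq).2).2.2 δ' (h0.trans hδδ') hδ'1)
      have hcn : ‖((n : ℂ) + 1)⁻¹‖ₑ = ENNReal.ofReal (((n : ℝ) + 1)⁻¹) := by
        rw [← ofReal_norm, norm_inv]
        congr 2
        exact_mod_cast Complex.norm_natCast (n + 1)
      calc _ ≤ ‖((n : ℂ) + 1)⁻¹‖ₑ * (C * (c * ENNReal.ofReal (majorant A K δ' n)) +
            ∑ q ∈ Finset.HasAntidiagonal.antidiagonal n,
              C * (c * ENNReal.ofReal (majorant A K δ' q.1 * majorant A K δ' q.2))) := by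
            refine (pairENorm_smul_le _ _ _ _).trans (mul_le_mul_right ?_ _)
            exact (hL.pairENorm_add_le (hsum δ).1 δ (s + 1)).trans
              (add_le_add bL ((hsum δ).2.trans (Finset.sum_le_sum bB)))
        _ = ‖((n : ℂ) + 1)⁻¹‖ₑ * (C * c * ENNReal.ofReal (majorant A K δ' n +
            ∑ q ∈ Finset.HasAntidiagonal.antidiagonal n,
              majorant A K δ' q.1 * majorant A K δ' q.2)) := by
            rw [ENNReal.ofReal_add (hmaj n)
              (Finset.sum_nonneg fun q _ => mul_nonneg (hmaj _) (hmaj _)),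
              ENNReal.ofReal_sum_of_nonneg fun q _ => mul_nonneg (hmaj _) (hmaj _),
              ← Finset.mul_sum, ← Finset.mul_sum]
            ring
        _ ≤ ‖((n : ℂ) + 1)⁻¹‖ₑ * (C * c * ENNReal.ofReal (9 * A * majorant A K δ' n)) := by
            refine mul_le_mul_right (mul_le_mul_right (ENNReal.ofReal_le_ofReal ?_) _) _
            have h1 := sum_majorant_le (A := A) hK0 hδ'1 n
            have h2 := mul_le_mul_of_nonneg_right hA (hmaj n)
            linarith
        _ = ENNReal.ofReal (((n : ℝ) + 1)⁻¹ * (estConst α β s * (((n : ℝ) + 2) / (1 - δ)) *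
            (9 * A * majorant A K δ' n))) := by
            rw [hcn, hCe, hc, hinv, ← ENNReal.ofReal_mul hC, ← ENNReal.ofReal_mul (by positivity),
              ← ENNReal.ofReal_mul (by positivity)]
        _ ≤ _ := ENNReal.ofReal_le_ofReal (majorant_step hA hC h1 n)

/-! ### Existence, uniqueness and the lifespan -/

lemma rate_pos (α β s : ℝ) {N : ℝ} (hN : 0 ≤ N) : 0 < rate α β s N := by
  have := estConst_pos α β s
  unfold rate
  positivity

lemma summable_majorant_mul_pow {A K δ ρ : ℝ} (hA : 0 ≤ A) (hK : 0 < K) (hδ : δ < 1)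
    (hρ : 0 ≤ ρ) (h : ρ < 1 / K * (1 - δ)) : Summable fun n => majorant A K δ n * ρ ^ n := by
  have hd : 0 < 1 - δ := by linarith
  have hq0 : 0 ≤ K * ρ / (1 - δ) := by positivity
  have hq1 : K * ρ / (1 - δ) < 1 := by
    rw [div_lt_one hd]
    calc K * ρ < K * (1 / K * (1 - δ)) := by gcongr
      _ = 1 - δ := by field_simp
  refine Summable.of_nonneg_of_le
    (fun n => mul_nonneg (majorant_nonneg hA hK.le hδ n) (pow_nonneg hρ n)) (fun n => ?_)
    ((summable_geometric_of_lt_one hq0 hq1).mul_left A)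
  have h1 : 1 / ((n : ℝ) + 1) ^ 2 ≤ 1 := by
    rw [div_le_one (by positivity)]
    exact one_le_pow₀ (by linarith [(Nat.cast_nonneg n : (0 : ℝ) ≤ n)])
  calc majorant A K δ n * ρ ^ n = A * (K * ρ / (1 - δ)) ^ n * (1 / ((n : ℝ) + 1) ^ 2) := by
        unfold majorant
        rw [div_pow, mul_pow]
        ring
    _ ≤ A * (K * ρ / (1 - δ)) ^ n * 1 := by gcongr
    _ = _ := mul_one _

/-- The Taylor coefficients do not depend on `δ`; only the norm in which they are summed does. The
factor `1 - δ` in the lifespan is the radius of convergence given by the majorant. -/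
theorem exists_isHolomorphicSolution (α β : ℝ) {s : ℝ} (hs : 1 ≤ s) {δ : ℝ} (hδ : 0 < δ)
    (hδ1 : δ < 1) {p : (ℝ → ℂ) × (ℝ → ℂ)} {N : ℝ} (hN : 0 ≤ N) (hp : HInfPair p)
    (hr : IsRealPair p) (hb : pairENorm 1 (s + 1) p ≤ ENNReal.ofReal N) :
    ∃ U : ℂ → EC δ (s + 1) × EC δ (s + 1),
      IsHolomorphicSolution α β p.1 p.2 (1 / rate α β s N * (1 - δ)) U ∧
      (∀ t : ℝ, |t| < 1 / rate α β s N * (1 - δ) → (U t).1 ∈ E δ (s + 1) ∧ (U t).2 ∈ E δ (s + 1)) ∧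
      ∀ W : ℂ → EC δ (s + 1) × EC δ (s + 1),
        IsHolomorphicSolution α β p.1 p.2 (1 / rate α β s N * (1 - δ)) W →
        Set.EqOn W U (Metric.ball 0 (1 / rate α β s N * (1 - δ))) := by
  have hs1 : 1 ≤ s + 1 := by linarith
  have : CompleteSpace (EC δ (s + 1)) := EC.completeSpace hδ hs1
  set K := rate α β s N
  have hK : 0 < K := rate_pos α β s hN
  set r := 1 / K * (1 - δ) with hr_def
  have hest := taylorCoeff_estimate α β hs hN hp hr hb
  have hbd := fun n => (hest n).2.2 δ hδ hδ1
  have hmaj := fun n => majorant_nonneg (by linarith : 0 ≤ 1 + N) hK.le hδ1 n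
  let a : ℕ → EC δ (s + 1) × EC δ (s + 1) := fun n =>
    (⟨(taylorCoeff α β p n).1, (hest n).1.fst.contDiff,
      ((fst_le_pairENorm _ _ _).trans (hbd n)).trans_lt ENNReal.ofReal_lt_top⟩,
    ⟨(taylorCoeff α β p n).2, (hest n).1.snd.contDiff,
      ((snd_le_pairENorm _ _ _).trans (hbd n)).trans_lt ENNReal.ofReal_lt_top⟩)
  have ha : ∀ n, toPair (a n) = taylorCoeff α β p n := fun n => rfl
  have hnorm : ∀ n, ‖a n‖ ≤ majorant (1 + N) K δ n := by
    intro n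
    have h := pairENorm_toPair (a n)
    rw [ha] at h
    have h1 : ‖(a n).1‖ₑ ≤ ENNReal.ofReal (majorant (1 + N) K δ n) :=
      (le_self_add.trans h.ge).trans (hbd n)
    have h2 : ‖(a n).2‖ₑ ≤ ENNReal.ofReal (majorant (1 + N) K δ n) :=
      (le_add_self.trans h.ge).trans (hbd n)
    rw [← ofReal_norm, ENNReal.ofReal_le_ofReal_iff (hmaj n)] at h1 h2
    exact norm_prod_le_iff.2 ⟨h1, h2⟩
  have hsum : ∀ ρ : ℝ, 0 ≤ ρ → ρ < r → Summable fun n => ‖a n‖ * ρ ^ n := fun ρ h0 h1 =>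
    Summable.of_nonneg_of_le (fun n => by positivity)
      (fun n => mul_le_mul_of_nonneg_right (hnorm n) (pow_nonneg h0 n))
      (summable_majorant_mul_pow (by linarith : 0 ≤ 1 + N) hK hδ1 h0 h1)
  have hsol : IsQuadraticSolution (evalCLM hδ hs1) (opLCLM α hδ hδ1 hs) (opBCLM β hδ hδ1 hs) r
      fun t => ∑' n, t ^ n • a n := by
    refine isQuadraticSolution_tsum hsum fun n j => ?_
    simp only [evalCLM_apply, opLCLM_apply, opBCLM_apply, ha]
    rw [taylorCoeff_succ, map_smul, map_add, map_sum, smul_eq_mul,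
      mul_inv_cancel_left₀ (by exact_mod_cast Nat.succ_ne_zero n)]
  have hU0 : (∑' n, (0 : ℂ) ^ n • a n) = a 0 := by
    rw [tsum_eq_single 0 fun n hn => by rw [zero_pow hn, zero_smul]]
    simp
  have hinit : toPair (∑' n, (0 : ℂ) ^ n • a n) = (p.1, p.2) := by
    rw [hU0, ha, taylorCoeff_zero]
  refine ⟨fun t => ∑' n, t ^ n • a n,
    (isHolomorphicSolution_iff α β hδ hδ1 hs hs1 _ _ _ _).2 ⟨hinit, hsol⟩, fun t ht => ?_,
    fun W hW => ?_⟩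
  · have hterms : Summable fun n => ((t : ℂ) ^ n) • a n := by
      refine Summable.of_norm ((hsum |t| (abs_nonneg t) ht).congr fun n => ?_)
      rw [norm_smul, norm_pow, Complex.norm_real, Real.norm_eq_abs, mul_comm]
    -- Point evaluation is continuous, so reality passes from the coefficients, weighted by the real
    -- numbers `t^n`, to the sum.
    have hreal : ∀ j, (evalPair j (toPair (∑' n, ((t : ℂ) ^ n) • a n))).im = 0 := by
      intro j
      have h := Complex.imCLM.hasSum ((evalCLM hδ hs1 j).hasSum hterms.hasSum)
      have hz : ∀ n, Complex.imCLM (evalCLM hδ hs1 j (((t : ℂ) ^ n) • a n)) = 0 := by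
        intro n
        have hn : (evalPair j (toPair (a n))).im = 0 := by
          obtain ⟨x, b⟩ := j
          cases b
          · exact ((hest n).2.1 x).2
          · exact ((hest n).2.1 x).1
        rw [map_smul, evalCLM_apply, smul_eq_mul, ← Complex.ofReal_pow, Complex.imCLM_apply,
          Complex.im_ofReal_mul, hn, mul_zero]
      simp only [hz] at h
      exact h.unique hasSum_zero
    exact ⟨fun x => hreal (x, true), fun x => hreal (x, false)⟩
  · obtain ⟨h0, hq⟩ := (isHolomorphicSolution_iff α β hδ hδ1 hs hs1 _ _ _ _).1 hW
    refine hsol.eqOn (eq_zero_of_evalCLM hδ hs1) hq ?_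
    have : toPair (W 0) = toPair (∑' n, (0 : ℂ) ^ n • a n) := h0.trans hinit.symm
    exact Prod.ext (Subtype.ext (congrArg Prod.fst this)) (Subtype.ext (congrArg Prod.snd this))

lemma pairNorm_nonneg {δ s : ℝ} (p : E δ s × E δ s) : 0 ≤ pairNorm p :=
  add_nonneg (norm_nonneg _) (norm_nonneg _)

end GenCH

theorem theorem2p2 (α β s : ℝ) (hs : 2 ≤ s) :
    ∃ T : GenCH.E 1 (s + 1) × GenCH.E 1 (s + 1) → ℝ,
      (∀ p : GenCH.E 1 (s + 1) × GenCH.E 1 (s + 1), 0 < T p ∧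
        ∀ δ : ℝ, 0 < δ → δ < 1 →
          ∃ U : ℂ → GenCH.EC δ (s + 1) × GenCH.EC δ (s + 1),
            GenCH.IsHolomorphicSolution α β (p.1 : GenCH.EC 1 (s + 1)) (p.2 : GenCH.EC 1 (s + 1))
              (T p * (1 - δ)) U ∧
            (∀ t : ℝ, |t| < T p * (1 - δ) →
              (U (t : ℂ)).1 ∈ GenCH.E δ (s + 1) ∧ (U (t : ℂ)).2 ∈ GenCH.E δ (s + 1)) ∧
            ∀ W : ℂ → GenCH.EC δ (s + 1) × GenCH.EC δ (s + 1),
              GenCH.IsHolomorphicSolution α β (p.1 : GenCH.EC 1 (s + 1))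
                (p.2 : GenCH.EC 1 (s + 1)) (T p * (1 - δ)) W →
              Set.EqOn W U (Metric.ball 0 (T p * (1 - δ)))) ∧
      (∃ c : ℝ, 0 < c ∧
        Tendsto (fun p => T p * GenCH.pairNorm p) (comap GenCH.pairNorm atTop) (𝓝 c)) ∧
      (∃ c : ℝ, 0 < c ∧ Tendsto T (comap GenCH.pairNorm (𝓝 0)) (𝓝 c)) := by
  have hC := GenCH.estConst_pos α β s
  -- With `C = estConst α β s`, the lifespan is `1/(216 C (1+N))`, a function of the norm `N` of the
  -- data alone. Both limits equal `1/(216 C)`.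
  refine ⟨fun p => 1 / GenCH.rate α β s (GenCH.pairNorm p), fun p => ⟨?_, fun δ hδ hδ1 => ?_⟩,
    ⟨1 / (216 * GenCH.estConst α β s), by positivity, ?_⟩,
    ⟨1 / (216 * GenCH.estConst α β s), by positivity, ?_⟩⟩
  · exact one_div_pos.2 (GenCH.rate_pos α β s (GenCH.pairNorm_nonneg p))
  · refine GenCH.exists_isHolomorphicSolution α β (by linarith) hδ hδ1
      (p := GenCH.toPair ((p.1 : GenCH.EC 1 (s + 1)), (p.2 : GenCH.EC 1 (s + 1))))
      (GenCH.pairNorm_nonneg p) (GenCH.hInfPair_toPair one_pos _)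
      (fun x => ⟨p.1.2 x, p.2.2 x⟩) ?_
    rw [GenCH.pairENorm_toPair, GenCH.pairNorm, ENNReal.ofReal_add (norm_nonneg _) (norm_nonneg _),
      ofReal_norm, ofReal_norm]
  · have h : Tendsto (fun N : ℝ => 1 / GenCH.rate α β s N * N) atTop
        (𝓝 (1 / (216 * GenCH.estConst α β s))) := by
      -- Since `N/(1+N) = 1 - 1/(1+N)`.
      have h1 : Tendsto (fun N : ℝ => 1 / (216 * GenCH.estConst α β s) * (1 - (1 + N)⁻¹)) atTop
          (𝓝 (1 / (216 * GenCH.estConst α β s) * (1 - 0))) :=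
        (tendsto_const_nhds.sub (tendsto_inv_atTop_zero.comp
          (tendsto_atTop_add_const_left atTop 1 tendsto_id))).const_mul _
      rw [sub_zero, mul_one] at h1
      refine h1.congr' ?_
      filter_upwards [eventually_gt_atTop 0] with N hN
      unfold GenCH.rate
      field_simp
      ring
    exact h.comp tendsto_comap
  -- Continuity at `N = 0`; the full neighbourhood filter `𝓝 0` includes zero data.
  · have h : Tendsto (fun N : ℝ => 1 / GenCH.rate α β s N) (𝓝 0)
        (𝓝 (1 / (216 * GenCH.estConst α β s))) := by
      have h1 : ContinuousAt (fun N : ℝ => 1 / GenCH.rate α β s N) 0 := by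
        unfold GenCH.rate
        refine continuousAt_const.div (by fun_prop) ?_
        simpa using hC.ne'
      have h2 := h1.tendsto
      simpa [GenCH.rate] using h2
    exact h.comp tendsto_comap
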